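/- All operators act on registers of qubits. The Pauli group consists of the tensor products of $I,X,Y,Z$ times $\pm1,\pm i$; a Clifford is a unitary that conjugates the Pauli group into itself; a PSC is a Clifford that is not in the Pauli group and whose square is in the Pauli group. Fix $k,s\in\mathbb N$. Let $\bar U=\bigotimes_{i=1}^{\ell}V_i$ be a tensor product of PSCs $V_i$ with disjoint supports, each acting on at most $k$ of $n$ data qubits, with $\bar U^2=I$. Let $g_1,\dots,g_m$ be tensor products of $I,X,Y,Z$ on the data qubits (e.g. stabilizer generators of a code), and let $w_q\ge 1$ be the maximum, over the data qubits, of the number of $g_j$ that act nontrivially on that qubit (the maximum column weight of the parity check matrix). Consider a Shor-style protocol with $r\ge 1$ rounds in any order; each round measures either $\bar U$ (a PSC round) or some subset of $\{g_1,\dots,g_m\}$ (a stabilizer round). Measuring $\bar U$ uses a fresh CAT state $(|0\cdots0\rangle+|1\cdots1\rangle)/\sqrt2$ on $\ell$ ancilla qubits, the $i$-th of which controls one gate $C(V_i)$; measuring $g_j$ uses a fresh CAT state with one ancilla qubit for each data qubit in the support of $g_j$, which controls one controlled-Pauli gate targeting that data qubit. Within a round the gates are applied in any order. Ancillas are never reused,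 and all measurements are postponed to the end. An error location is a point in time (before the first gate, between two gates, or after the last gate) together with a set of at most $s$ qubits; an error configuration on $M'$ error locations assigns to each of them a Pauli error supported on its qubits. Then any error configuration on any $M'$ error locations propagates to an end-of-circuit Clifford error of $O(M'r^2w_q)$ one- and two-qubit gates: there is a constant $K$, depending only on $k$ and $s$, such that the noisy circuit (up to the final measurements) equals $C\cdot(\text{noiseless circuit})$, where $C$ is a Clifford and a product of at most $K\,M'\,r^2\,w_q$ one- and two-qubit Clifford gates. In particular, for every data state $\psi$, the noisy final state obtained from $\psi$ and the CAT states is $C$ applied to the noiseless final state. The bound depends neither on $n$, $m$, $\ell$, nor on the maximum weight $w_c$ of the $g_j$. -/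

import Mathlib

open scoped Matrix

namespace ShorStyle

/-- Operators on a register of qubits indexed by `ι`, in the computational basis `ι → Fin 2`. -/
abbrev Op (ι : Type) : Type := Matrix (ι → Fin 2) (ι → Fin 2) ℂ

/-- Labels of the single-qubit Pauli matrices. -/
inductive Pauli : Type
  | I | X | Y | Z
  deriving DecidableEq

/-- The single-qubit Pauli matrices. -/
def Pauli.mat : Pauli → Matrix (Fin 2) (Fin 2) ℂ
  | .I => !![1, 0; 0, 1]
  | .X => !![0, 1; 1, 0]
  | .Y => !![0, -Complex.I; Complex.I, 0]
  | .Z => !![1, 0; 0, -1]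

open Classical in
/-- The operator `A` of a small register `κ`, applied to the qubits `f j` of the register `ι`, and
tensored with the identity on all the other qubits. -/
noncomputable def onQubits {ι κ : Type} (f : κ ↪ ι) (A : Op κ) : Op ι :=
  fun x y => if ∀ i, i ∉ Set.range f → x i = y i then A (x ∘ f) (y ∘ f) else 0

section Registers

variable {ι : Type} [Fintype ι] [DecidableEq ι]

/-- The tensor product of the single-qubit Pauli matrices `p i`. -/
def pauliString (p : ι → Pauli) : Op ι :=
  fun x y => ∏ i, (p i).mat (x i) (y i)

/-- Membership in the Pauli group: a Pauli string times `1`, `-1`, `i` or `-i`. -/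
def IsPauli (A : Op ι) : Prop :=
  ∃ (c : ℂ) (p : ι → Pauli), c ^ 4 = 1 ∧ A = c • pauliString p

/-- Membership in the Clifford group: a unitary that conjugates the Pauli group into itself. -/
def IsClifford (A : Op ι) : Prop :=
  A ∈ Matrix.unitaryGroup (ι → Fin 2) ℂ ∧ ∀ B : Op ι, IsPauli B → IsPauli (A * B * Aᴴ)

/-- Pauli-square-root Cliffords: non-Pauli Cliffords whose square is a Pauli. -/
def IsPSC (A : Op ι) : Prop :=
  IsClifford A ∧ ¬ IsPauli A ∧ IsPauli (A * A)

/-- `|0⟩⟨0| ⊗ 1 + |1⟩⟨1| ⊗ A` with control qubit `a`, where `A` acts trivially on `a`. -/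
def controlled (a : ι) (A : Op ι) : Op ι :=
  Matrix.diagonal (fun x => if x a = 0 then 1 else 0) +
    Matrix.diagonal (fun x => if x a = 1 then 1 else 0) * A

/-- A one- or two-qubit Clifford gate on the register `ι`. -/
def IsOneOrTwoQubitClifford (G : Op ι) : Prop :=
  ∃ (d : ℕ) (f : Fin d ↪ ι) (A : Op (Fin d)),
    (d = 1 ∨ d = 2) ∧ IsClifford A ∧ G = onQubits f A

/-- The unitary of a noiseless circuit, the head of the list being the first gate applied. -/
def idealCircuit : List (Op ι) → Op ι
  | [] => 1
  | G :: L => idealCircuit L * G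

/-- The operator of a circuit in which the error `E t` happens after the first `t` gates. -/
def noisyCircuit : List (Op ι) → (ℕ → Op ι) → Op ι
  | [], E => E 0
  | G :: L, E => noisyCircuit L (fun t => E (t + 1)) * G * E 0

end Registers

/-- A transversal PSC of order two on `n` data qubits with `ℓ` tensor factors: the factor `V i` is
a PSC on `arity i` qubits and acts on the data qubits `site i`; distinct factors have disjoint
supports. -/
structure TransversalPSC (n ℓ : ℕ) where
  arity : Fin ℓ → ℕ
  site : ∀ i, Fin (arity i) ↪ Fin n
  V : ∀ i, Op (Fin (arity i))
  isPSC : ∀ i, IsPSC (V i)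
  disjoint : ∀ i j, i ≠ j → Disjoint (Set.range (site i)) (Set.range (site j))
  /-- The tensor product of all the factors squares to the identity. -/
  order_two : (List.ofFn fun i => onQubits (site i) (V i)).prod ^ 2 = 1

/-- A round measures the transversal PSC, or a set of checks (out of `m` checks). -/
inductive Round (m : ℕ) : Type
  | psc : Round m
  | stab (s : Finset (Fin m)) : Round m

/-- The ancilla qubits. In a PSC round `t`, there is one ancilla `(t, i)` for every tensor factor
`i`; in a round `t` that measures the checks in `s`, there is one ancilla `(t, j, q)` for every check
`j ∈ s` and every data qubit `q` in the support of the check `j`. Ancillas are never reused. -/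
def IsAncilla {n m r : ℕ} (ℓ : ℕ) (check : Fin m → Fin n → Pauli) (round : Fin r → Round m) :
    Fin r × (Fin ℓ ⊕ Fin m × Fin n) → Prop
  | (t, .inl _) => round t = .psc
  | (t, .inr (j, q)) => ∃ s, round t = .stab s ∧ j ∈ s ∧ check j q ≠ .I

/-- A Shor-style protocol on `n` data qubits with `r` rounds, each of which measures a fixed
transversal PSC `U` with `ℓ` factors, or some of the `m` Pauli operators `check j`.
Measurements are postponed to the end. The checks are typically generators of a stabilizer code and `U`
is a logical operator of it; the checks may be arbitrary Pauli strings here.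

An operator that is measured is coupled to a CAT state with one qubit per tensor factor of the
operator; each qubit of the CAT state controls exactly one gate. Hence a gate is identified with its
control ancilla. The gates are applied in the order of the list `schedule`: round after round, in any
order within a round. -/
structure ShorProtocol (n ℓ m r : ℕ) where
  U : TransversalPSC n ℓ
  check : Fin m → Fin n → Pauli
  round : Fin r → Round m
  schedule : List {a // IsAncilla ℓ check round a}
  schedule_nodup : schedule.Nodup
  mem_schedule : ∀ a, a ∈ schedule
  schedule_sorted : schedule.Pairwise fun a b => a.1.1 ≤ b.1.1

namespace ShorProtocol

variable {n ℓ m r : ℕ} (P : ShorProtocol n ℓ m r)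

/-- The ancilla qubits of the protocol. -/
abbrev Ancilla : Type := {a // IsAncilla ℓ P.check P.round a}

noncomputable instance : Fintype P.Ancilla :=
  @Subtype.fintype _ _ (Classical.decPred _) inferInstance

/-- The qubits of the protocol: data qubits and ancilla qubits. -/
abbrev Qubit : Type := Fin n ⊕ P.Ancilla

/-- The parameter `w_q`: the largest column weight of the parity check matrix, that is, the largest
number of checks that act nontrivially on one data qubit. -/
def wq : ℕ := Finset.univ.sup fun q : Fin n =>
  (Finset.univ.filter fun j : Fin m => P.check j q ≠ .I).card

/-- The gate controlled by the ancilla `a`: controlled-`V i` in a PSC round, and the controlled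
single-qubit Pauli `check j q` with target `q` in a stabilizer round. -/
noncomputable def gate (a : P.Ancilla) : Op P.Qubit :=
  match a.1.2 with
  | .inl i => controlled (.inr a)
      (onQubits ((P.U.site i).trans Function.Embedding.inl) (P.U.V i))
  | .inr (j, q) => controlled (.inr a)
      (pauliString (Function.update (fun _ => Pauli.I) (.inl q) (P.check j q)))

/-- The gates of the protocol, in the order in which they are applied. -/
noncomputable def gates : List (Op P.Qubit) := P.schedule.map P.gate

/-- The unitary of the noiseless protocol, up to the final measurement of the ancillas. -/
noncomputable def ideal : Op P.Qubit := idealCircuit P.gates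

/-- An error location: a time `t` (after `t` gates), and the set of qubits the error may act on.
Time `0` is for initialization errors, and the largest time for errors of the final measurement;
gate errors and idling errors follow or precede a gate. -/
structure ErrorLocation where
  time : Fin (P.gates.length + 1)
  qubits : Finset P.Qubit

/-- `M` error locations, with a (possibly trivial) Pauli error at every one of them. -/
structure ErrorConfiguration (M : ℕ) where
  loc : Fin M → P.ErrorLocation
  err : Fin M → P.Qubit → Pauli
  err_supp : ∀ i q, q ∉ (loc i).qubits → err i q = .I

variable {P} in
/-- The Pauli error that happens at time `t`. -/
noncomputable def ErrorConfiguration.errorAt {M : ℕ} (e : P.ErrorConfiguration M) (t : ℕ) :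
    Op P.Qubit :=
  (((List.finRange M).filter fun i => ((e.loc i).time : ℕ) = t).map
    fun i => pauliString (e.err i)).prod

/-- The operator of the noisy protocol, up to the final measurement of the ancillas. -/
noncomputable def noisy {M : ℕ} (e : P.ErrorConfiguration M) : Op P.Qubit :=
  noisyCircuit P.gates e.errorAt

end ShorProtocol

open Classical in
/-- The amplitudes of the CAT state `(|0…0⟩ + |1…1⟩) / √2`. -/
noncomputable def cat {α : Type} (x : α → Fin 2) : ℂ :=
  (1 / (Real.sqrt 2 : ℂ)) * ((if ∀ a, x a = 0 then 1 else 0) + (if ∀ a, x a = 1 then 1 else 0))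

/-- The input of the protocol: the state `ψ` of the data qubits, one CAT state for every PSC round,
and one CAT state for every check that is measured in a stabilizer round. -/
noncomputable def ShorProtocol.input {n ℓ m r : ℕ} (P : ShorProtocol n ℓ m r)
    (ψ : (Fin n → Fin 2) → ℂ) : (P.Qubit → Fin 2) → ℂ :=
  fun x => ψ (fun q => x (.inl q)) * ∏ t : Fin r,
    match P.round t with
    | .psc => cat fun a : {a : P.Ancilla // a.1.1 = t} => x (.inr a.1)
    | .stab s => ∏ j ∈ s,
        cat fun a : {a : P.Ancilla // ∃ q, a.1 = (t, Sum.inr (j, q))} => x (.inr a.1)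

end ShorStyle

open ShorStyle

/-! In the computational basis of the ancillas every gate is block diagonal: the gate of ancilla `b`
is `ctl b` of `act b`, which applies `act b` to the data on the blocks where bit `b` is 1. An error
is pushed to the end of the circuit, and the operators it picks up on the way are counted.
`Propagates` is multiplicative in the error, so it suffices to treat one single-qubit Pauli
(`propagates_onQubit`); all estimates hold for any duplicate-free list of gates, hence for every
remaining part of the circuit.

A `Z` on an ancilla commutes with all gates. A Pauli `p` on a data qubit anticommutes with at most
`r * wq` of the controlled checks, each crossing leaving a `Z` on the control. It meets at most `r`
controlled factors, each leaving a controlled Pauli `p * (v * p * vᴴ)`. That controlled Pauli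
commutes or anticommutes with every later `act b`, so it leaves only controlled signs, on at most `k
* r * wq + r` ancillas. This is the source of `r ^ 2 * wq`.

An `X` on ancilla `a` crosses its own gate at the price of a controlled phase and an uncontrolled
`act a` on the data. If `act a` is a factor `v`, later checks turn it into `p x * v * (p x)ᴴ`, where
the Pauli `p x` depends on the ancilla bits `x`. Crossing another copy of controlled `v` then costs
a controlled sign `χ x`. The crucial point is `exists_sign`: multiplying `p` by a Pauli `A`
multiplies `χ` by a sign that depends on `A` and not on `p`. So `χ` is a character of the bits, and
its controlled version is a product of linearly many controlled-`Z` gates (`propagates_blk_factor`).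

All this rests on `v * v` being scalar. It follows from the order two of the whole tensor product,
since conjugating twice by the product is trivial on each factor (`exists_factor_sq`).

Gate counts come from Pauli rotations: a rotation of weight `w` takes `2 * w + 1` gates
(`hasCost_rot`), controlled Paulis are products of three commuting rotations and a phase
(`ctl_eq_rot`), and a Clifford on `k` qubits is a scalar times at most `4 * k` rotations
(`IsClifford.eq_smul_isRotProd`). -/

namespace ShorStyle

set_option linter.unusedSectionVars false

/-! ### Tensor products of single-qubit operators -/

namespace Pauli

/-- The product of two Pauli matrices, up to a phase. -/
def mul : Pauli → Pauli → Pauli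
  | I, q => q
  | p, I => p
  | X, X => I
  | X, Y => Z
  | X, Z => Y
  | Y, X => Z
  | Y, Y => I
  | Y, Z => X
  | Z, X => Y
  | Z, Y => X
  | Z, Z => I

/-- The phase in the product of two Pauli matrices. -/
noncomputable def phase : Pauli → Pauli → ℂ
  | X, Y => Complex.I
  | X, Z => -Complex.I
  | Y, X => -Complex.I
  | Y, Z => Complex.I
  | Z, X => Complex.I
  | Z, Y => -Complex.I
  | _, _ => 1

/-- The sign in the commutation relation of two Pauli matrices. -/
noncomputable def sign : Pauli → Pauli → ℂ
  | X, Y | X, Z | Y, X | Y, Z | Z, X | Z, Y => -1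
  | _, _ => 1

instance : Fintype Pauli := ⟨{.I, .X, .Y, .Z}, fun p => by cases p <;> decide⟩

theorem sum_eq {M : Type*} [AddCommMonoid M] (f : Pauli → M) :
    ∑ p, f p = f .I + (f .X + (f .Y + f .Z)) := by
  have : (Finset.univ : Finset Pauli) = {.I, .X, .Y, .Z} := rfl
  rw [this, Finset.sum_insert (by decide), Finset.sum_insert (by decide),
    Finset.sum_insert (by decide), Finset.sum_singleton]

@[simp] theorem mat_I : Pauli.I.mat = 1 := by
  ext i j; fin_cases i <;> fin_cases j <;> simp [mat]

theorem mat_mul (p q : Pauli) : p.mat * q.mat = phase p q • (mul p q).mat := by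
  cases p <;> cases q <;> ext i j <;> fin_cases i <;> fin_cases j <;> simp [mat, mul, phase]

theorem phase_pow (p q : Pauli) : phase p q ^ 4 = 1 := by
  cases p <;> cases q <;> simp [phase, Even.neg_pow (by decide : Even 4)]

theorem mat_mul_comm (p q : Pauli) : p.mat * q.mat = sign p q • (q.mat * p.mat) := by
  cases p <;> cases q <;> ext i j <;> fin_cases i <;> fin_cases j <;> simp [mat, sign]

theorem sign_eq (p q : Pauli) : sign p q = 1 ∨ sign p q = -1 := by
  cases p <;> cases q <;> simp [sign]

@[simp] theorem mul_self (p : Pauli) : mul p p = I := by cases p <;> rfl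

@[simp] theorem mat_mul_self (p : Pauli) : p.mat * p.mat = 1 := by
  cases p <;> ext i j <;> fin_cases i <;> fin_cases j <;> simp [mat]

@[simp] theorem mat_conjTranspose (p : Pauli) : p.matᴴ = p.mat := by
  cases p <;> ext i j <;> fin_cases i <;> fin_cases j <;> simp [mat]

theorem exists_anticommuting {p : Pauli} (h : p ≠ I) : ∃ q, sign q p = -1 := by
  cases p
  · exact absurd rfl h
  · exact ⟨Z, rfl⟩
  · exact ⟨Z, rfl⟩
  · exact ⟨X, rfl⟩

/-- The Pauli matrices are an orthogonal basis for the trace form; these are the coefficients of a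
matrix unit in it. -/
theorem completeness (a b u v : Fin 2) :
    ∑ p : Pauli, (1 / 2 * p.mat b a) * p.mat u v = if u = a ∧ v = b then 1 else 0 := by
  rw [sum_eq]
  fin_cases a <;> fin_cases b <;> fin_cases u <;> fin_cases v <;>
    norm_num [mat, Complex.ext_iff]

end Pauli

section Tensor

variable {ι : Type} [Fintype ι]

/-- The tensor product of single-qubit operators. -/
def tensor (A : ι → Matrix (Fin 2) (Fin 2) ℂ) : Op ι :=
  fun x y => ∏ i, A i (x i) (y i)

theorem pauliString_eq_tensor (p : ι → Pauli) : pauliString p = tensor fun i => (p i).mat := rfl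

variable [DecidableEq ι]

theorem tensor_mul (A B : ι → Matrix (Fin 2) (Fin 2) ℂ) :
    tensor A * tensor B = tensor fun i => A i * B i := by
  ext x y
  simp only [tensor, Matrix.mul_apply, Finset.prod_univ_sum, Fintype.piFinset_univ,
    Finset.prod_mul_distrib]

theorem tensor_smul (c : ι → ℂ) (A : ι → Matrix (Fin 2) (Fin 2) ℂ) :
    tensor (fun i => c i • A i) = (∏ i, c i) • tensor A := by
  ext x y
  simp [tensor, Finset.prod_mul_distrib]

theorem tensor_one : tensor (fun _ : ι => 1) = 1 := by
  ext x y
  simp only [tensor, Matrix.one_apply, Finset.prod_ite_zero, funext_iff]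
  simp

theorem tensor_conjTranspose (A : ι → Matrix (Fin 2) (Fin 2) ℂ) :
    (tensor A)ᴴ = tensor fun i => (A i)ᴴ := by
  ext x y
  simp [tensor, Matrix.conjTranspose_apply]

theorem pauliString_I : pauliString (fun _ : ι => Pauli.I) = 1 := by
  simp [pauliString_eq_tensor, tensor_one]

theorem pauliString_mul_self (p : ι → Pauli) : pauliString p * pauliString p = 1 := by
  simp [pauliString_eq_tensor, tensor_mul, tensor_one]

theorem pauliString_conjTranspose (p : ι → Pauli) : (pauliString p)ᴴ = pauliString p := by
  simp [pauliString_eq_tensor, tensor_conjTranspose]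

theorem pauliString_mul (p q : ι → Pauli) : pauliString p * pauliString q =
    (∏ i, (p i).phase (q i)) • pauliString fun i => (p i).mul (q i) := by
  simp only [pauliString_eq_tensor, tensor_mul, Pauli.mat_mul, tensor_smul]

theorem pauliString_mul_comm (p q : ι → Pauli) : pauliString p * pauliString q =
    (∏ i, (p i).sign (q i)) • (pauliString q * pauliString p) := by
  simp only [pauliString_eq_tensor, tensor_mul, fun i => Pauli.mat_mul_comm (p i) (q i),
    tensor_smul]

/-- A matrix unit is the tensor product of single-qubit matrix units; expanding each by
`Pauli.completeness` and multiplying out gives a sum over Pauli strings. -/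
theorem single_mem_span (x y : ι → Fin 2) :
    Matrix.single x y (1 : ℂ) ∈ Submodule.span ℂ (Set.range (pauliString (ι := ι))) := by
  have : Matrix.single x y (1 : ℂ) =
      ∑ p : ι → Pauli, (∏ i, 1 / 2 * (p i).mat (y i) (x i)) • pauliString p := by
    ext u v
    have h := Finset.prod_univ_sum (fun _ : ι => (Finset.univ : Finset Pauli))
      fun i p => (1 / 2 * p.mat (y i) (x i)) * p.mat (u i) (v i)
    rw [Fintype.piFinset_univ] at h
    simp only [Pauli.completeness, Finset.prod_mul_distrib, Finset.prod_ite_zero] at h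
    simp only [Matrix.sum_apply, Matrix.smul_apply, smul_eq_mul, pauliString,
      Finset.prod_mul_distrib, ← h, Matrix.single_apply, funext_iff]
    simp only [Finset.mem_univ, true_imp_iff, forall_and, eq_comm, Finset.prod_const_one]
  rw [this]
  exact Submodule.sum_mem _ fun p _ => Submodule.smul_mem _ _ (Submodule.subset_span ⟨p, rfl⟩)

/-- Pauli strings span all operators, so linear identities need checking only on tensor products,
where they hold factor by factor. -/
theorem op_induction {C : Op ι → Prop} (add : ∀ A B, C A → C B → C (A + B))
    (smul : ∀ (c : ℂ) A, C A → C (c • A)) (pauli : ∀ p, C (pauliString p)) (A : Op ι) : C A := by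
  have hA : A ∈ Submodule.span ℂ (Set.range (pauliString (ι := ι))) := by
    rw [Matrix.matrix_eq_sum_single A]
    refine Submodule.sum_mem _ fun x _ => Submodule.sum_mem _ fun y _ => ?_
    rw [← mul_one (A x y), ← smul_eq_mul, ← Matrix.smul_single]
    exact Submodule.smul_mem _ _ (single_mem_span x y)
  induction hA using Submodule.span_induction with
  | mem A h => obtain ⟨p, rfl⟩ := h; exact pauli p
  | zero => simpa using smul 0 _ (pauli fun _ => .I)
  | add A B _ _ hA hB => exact add A B hA hB
  | smul c A _ hA => exact smul c A hA

/-- An operator that commutes with all Pauli strings is a scalar. -/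
theorem eq_smul_one_of_commute {A : Op ι} (h : ∀ p, Commute (pauliString p) A) :
    ∃ c : ℂ, A = c • 1 := by
  have h' : ∀ B : Op ι, Commute B A := op_induction (fun _ _ => Commute.add_left)
    (fun c _ h => h.smul_left c) h
  obtain ⟨c, hc⟩ := Matrix.mem_range_scalar_iff_commute_single.2
    fun i j (_ : i ≠ j) => h' (Matrix.single i j 1)
  exact ⟨c, by rw [← hc, Matrix.scalar_apply, Matrix.smul_one_eq_diagonal]⟩

end Tensor

/-! ### Operators on a part of the register -/

section OnQubits

variable {ι κ μ : Type}

theorem onQubits_add (f : κ ↪ ι) (A B : Op κ) :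
    onQubits f (A + B) = onQubits f A + onQubits f B := by
  ext x y
  by_cases h : ∀ i, i ∉ Set.range f → x i = y i
  · simp only [onQubits, if_pos h, Matrix.add_apply]
  · simp only [onQubits, if_neg h, Matrix.add_apply, add_zero]

theorem onQubits_smul (f : κ ↪ ι) (c : ℂ) (A : Op κ) :
    onQubits f (c • A) = c • onQubits f A := by
  ext x y
  by_cases h : ∀ i, i ∉ Set.range f → x i = y i
  · simp only [onQubits, if_pos h, Matrix.smul_apply]
  · simp only [onQubits, if_neg h, Matrix.smul_apply, smul_zero]

/-- The entries of the small operator are read off at states extended by 0 outside the range. This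
lets identities on the full register be pulled back to the few qubits involved. -/
theorem onQubits_injective (f : κ ↪ ι) : Function.Injective (onQubits f) := by
  intro A B h
  ext u v
  have := congrFun (congrFun h (Function.extend f u 0)) (Function.extend f v 0)
  have h' : ∀ i, i ∉ Set.range f → Function.extend f u 0 i = Function.extend f v 0 i :=
    fun i hi => by rw [Function.extend_apply' _ _ _ hi, Function.extend_apply' _ _ _ hi]
  have hc : ∀ w : κ → Fin 2, Function.extend f w 0 ∘ f = w :=
    fun w => funext fun j => f.injective.extend_apply _ _ j
  simpa only [onQubits, if_pos h', hc] using this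

variable [Fintype ι] [DecidableEq ι] [Fintype κ] [DecidableEq κ] [Fintype μ] [DecidableEq μ]

theorem onQubits_tensor (f : κ ↪ ι) (A : κ → Matrix (Fin 2) (Fin 2) ℂ) :
    onQubits f (tensor A) = tensor (Function.extend f A fun _ => 1) := by
  ext x y
  by_cases h : ∀ i, i ∉ Set.range f → x i = y i
  · simp only [onQubits, if_pos h, tensor]
    rw [← Finset.prod_subset (Finset.subset_univ (Finset.univ.map f)), Finset.prod_map]
    · simp [f.injective.extend_apply]
    · intro i _ hi
      have hi : i ∉ Set.range f := by simpa using hi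
      rw [Function.extend_apply' _ _ _ hi, h i hi, Matrix.one_apply_eq]
  · simp only [onQubits, if_neg h, tensor]
    push Not at h
    obtain ⟨i, hi, hne⟩ := h
    refine (Finset.prod_eq_zero (Finset.mem_univ i) ?_).symm
    rw [Function.extend_apply' _ _ _ hi, Matrix.one_apply_ne hne]

theorem onQubits_pauliString (f : κ ↪ ι) (p : κ → Pauli) :
    onQubits f (pauliString p) = pauliString (Function.extend f p fun _ => .I) := by
  rw [pauliString_eq_tensor, onQubits_tensor, pauliString_eq_tensor]
  congr 1
  ext1 i
  by_cases hi : i ∈ Set.range f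
  · obtain ⟨j, rfl⟩ := hi
    simp only [f.injective.extend_apply]
  · simp only [Function.extend_apply' _ _ _ hi, Pauli.mat_I]

theorem onQubits_one (f : κ ↪ ι) : onQubits f (1 : Op κ) = 1 := by
  rw [← pauliString_I, onQubits_pauliString, ← pauliString_I]
  congr 1
  ext1 i
  by_cases hi : i ∈ Set.range f
  · obtain ⟨j, rfl⟩ := hi
    simp only [f.injective.extend_apply]
  · simp only [Function.extend_apply' _ _ _ hi]

theorem onQubits_mul (f : κ ↪ ι) (A B : Op κ) :
    onQubits f (A * B) = onQubits f A * onQubits f B := by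
  induction A using op_induction with
  | add A A' h h' => rw [add_mul, onQubits_add, h, h', onQubits_add, add_mul]
  | smul c A h => rw [smul_mul_assoc, onQubits_smul, h, onQubits_smul, smul_mul_assoc]
  | pauli p =>
    induction B using op_induction with
    | add A A' h h' => rw [mul_add, onQubits_add, h, h', onQubits_add, mul_add]
    | smul c A h => rw [mul_smul_comm, onQubits_smul, h, onQubits_smul, mul_smul_comm]
    | pauli q =>
      simp only [pauliString_eq_tensor, tensor_mul, onQubits_tensor]
      congr 1
      ext1 i
      by_cases hi : i ∈ Set.range f
      · obtain ⟨j, rfl⟩ := hi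
        simp only [f.injective.extend_apply]
      · simp only [Function.extend_apply' _ _ _ hi, mul_one]

/-- The embedding of the operators on a part of the register, as an algebra homomorphism. -/
noncomputable def onQubitsHom (f : κ ↪ ι) : Op κ →ₐ[ℂ] Op ι :=
  AlgHom.ofLinearMap ⟨⟨onQubits f, onQubits_add f⟩, onQubits_smul f⟩ (onQubits_one f)
    (onQubits_mul f)

theorem onQubitsHom_apply (f : κ ↪ ι) (A : Op κ) : onQubitsHom f A = onQubits f A := rfl

theorem onQubits_trans (f : κ ↪ μ) (g : μ ↪ ι) (A : Op κ) :
    onQubits (f.trans g) A = onQubits g (onQubits f A) := by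
  induction A using op_induction with
  | add A B hA hB => simp only [onQubits_add, hA, hB]
  | smul c A hA => simp only [onQubits_smul, hA]
  | pauli p =>
    simp only [onQubits_pauliString]
    congr 1
    ext1 i
    by_cases hi : i ∈ Set.range g
    · obtain ⟨j, rfl⟩ := hi
      rw [g.injective.extend_apply]
      by_cases hj : j ∈ Set.range f
      · obtain ⟨k, rfl⟩ := hj
        rw [f.injective.extend_apply]
        exact (f.trans g).injective.extend_apply _ _ k
      · rw [Function.extend_apply' _ _ _ hj, Function.extend_apply']
        rintro ⟨k, hk⟩
        exact hj ⟨k, g.injective hk⟩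
    · rw [Function.extend_apply' _ _ _ hi, Function.extend_apply']
      rintro ⟨k, rfl⟩
      exact hi ⟨f k, rfl⟩

theorem onQubits_commute {f : κ ↪ ι} {g : μ ↪ ι} (h : Disjoint (Set.range f) (Set.range g))
    (A : Op κ) (B : Op μ) : Commute (onQubits f A) (onQubits g B) := by
  induction A using op_induction with
  | add A A' h h' => rw [onQubits_add]; exact h.add_left h'
  | smul c A h => rw [onQubits_smul]; exact h.smul_left c
  | pauli p =>
    induction B using op_induction with
    | add A A' h h' => rw [onQubits_add]; exact h.add_right h'
    | smul c A h => rw [onQubits_smul]; exact h.smul_right c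
    | pauli q =>
      simp only [pauliString_eq_tensor, onQubits_tensor, commute_iff_eq, tensor_mul]
      congr 1
      ext1 i
      by_cases hi : i ∈ Set.range f
      · rw [Function.extend_apply' (f := g) _ _ _ (Set.disjoint_left.1 h hi), mul_one, one_mul]
      · rw [Function.extend_apply' (f := f) _ _ _ hi, mul_one, one_mul]

end OnQubits

/-! ### Pauli operators -/

section PauliOperators

variable {ι κ : Type} [Fintype ι] [DecidableEq ι] [Fintype κ] [DecidableEq κ]

theorem smul_one_injective : Function.Injective fun c : ℂ => c • (1 : Op ι) := by
  intro c d h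
  simpa using congrFun (congrFun h 0) 0

/-- Pauli operators supported on the qubits in `T`. -/
def PauliOn (T : Finset ι) (A : Op ι) : Prop :=
  ∃ (c : ℂ) (p : ι → Pauli), c ^ 4 = 1 ∧ (∀ i, i ∉ T → p i = .I) ∧ A = c • pauliString p

theorem PauliOn.isPauli {T : Finset ι} {A : Op ι} (h : PauliOn T A) : IsPauli A := by
  obtain ⟨c, p, hc, -, rfl⟩ := h
  exact ⟨c, p, hc, rfl⟩

theorem IsPauli.pauliOn {A : Op ι} (h : IsPauli A) : PauliOn Finset.univ A := by
  obtain ⟨c, p, hc, rfl⟩ := h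
  exact ⟨c, p, hc, fun i hi => absurd (Finset.mem_univ i) hi, rfl⟩

theorem PauliOn.mono {S T : Finset ι} (hST : S ⊆ T) {A : Op ι} (h : PauliOn S A) :
    PauliOn T A := by
  obtain ⟨c, p, hc, hp, rfl⟩ := h
  exact ⟨c, p, hc, fun i hi => hp i fun h => hi (hST h), rfl⟩

theorem prod_phase_pow (p q : ι → Pauli) : (∏ i, (p i).phase (q i)) ^ 4 = 1 := by
  rw [← Finset.prod_pow]
  exact Finset.prod_eq_one fun i _ => Pauli.phase_pow _ _

theorem PauliOn.mul {T : Finset ι} {A B : Op ι} (hA : PauliOn T A) (hB : PauliOn T B) :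
    PauliOn T (A * B) := by
  obtain ⟨c, p, hc, hp, rfl⟩ := hA
  obtain ⟨d, q, hd, hq, rfl⟩ := hB
  refine ⟨c * d * ∏ i, (p i).phase (q i), fun i => (p i).mul (q i), ?_, ?_, ?_⟩
  · rw [mul_pow, mul_pow, hc, hd, prod_phase_pow]; norm_num
  · intro i hi
    simp [hp i hi, hq i hi]
  · rw [smul_mul_smul_comm, pauliString_mul, smul_smul]

theorem PauliOn.smul {T : Finset ι} {A : Op ι} (hA : PauliOn T A) {c : ℂ} (hc : c ^ 4 = 1) :
    PauliOn T (c • A) := by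
  obtain ⟨d, q, hd, hq, rfl⟩ := hA
  exact ⟨c * d, q, by rw [mul_pow, hc, hd, one_mul], hq, by rw [smul_smul]⟩

theorem PauliOn.onQubits {f : κ ↪ ι} {T : Finset κ} {A : Op κ} (hA : PauliOn T A) :
    PauliOn (T.map f) (onQubits f A) := by
  obtain ⟨c, p, hc, hp, rfl⟩ := hA
  refine ⟨c, _, hc, ?_, by rw [onQubits_smul, onQubits_pauliString]⟩
  intro i hi
  by_cases h : i ∈ Set.range f
  · obtain ⟨j, rfl⟩ := h
    rw [f.injective.extend_apply]
    exact hp j (by simpa using hi)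
  · exact Function.extend_apply' _ _ _ h

theorem IsPauli.mul {A B : Op ι} (hA : IsPauli A) (hB : IsPauli B) : IsPauli (A * B) :=
  (hA.pauliOn.mul hB.pauliOn).isPauli

theorem IsPauli.smul {A : Op ι} (hA : IsPauli A) {c : ℂ} (hc : c ^ 4 = 1) : IsPauli (c • A) :=
  (hA.pauliOn.smul hc).isPauli

theorem isPauli_pauliString (p : ι → Pauli) : IsPauli (pauliString p) :=
  ⟨1, p, by simp, by simp⟩

theorem isPauli_one : IsPauli (1 : Op ι) := pauliString_I (ι := ι) ▸ isPauli_pauliString _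

theorem I_pow_four : Complex.I ^ 4 = 1 := by simp

/-- The signs of the tensor factors multiply, so only one overall sign remains. Every propagation
argument below is a case split on this sign. -/
theorem IsPauli.mul_comm {A B : Op ι} (hA : IsPauli A) (hB : IsPauli B) :
    A * B = B * A ∨ A * B = -(B * A) := by
  obtain ⟨c, p, hc, rfl⟩ := hA
  obtain ⟨d, q, hd, rfl⟩ := hB
  have h : ∏ i, (p i).sign (q i) = 1 ∨ ∏ i, (p i).sign (q i) = -1 := by
    refine Finset.prod_induction _ (fun x : ℂ => x = 1 ∨ x = -1) ?_ (Or.inl rfl)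
      fun i _ => Pauli.sign_eq _ _
    rintro x y (rfl | rfl) (rfl | rfl) <;> simp
  rw [smul_mul_smul_comm, smul_mul_smul_comm, pauliString_mul_comm, _root_.mul_comm d c]
  rcases h with h | h <;> rw [h] <;> simp

theorem IsPauli.conjTranspose {A : Op ι} (hA : IsPauli A) : IsPauli Aᴴ := by
  obtain ⟨c, p, hc, rfl⟩ := hA
  refine ⟨star c, p, by rw [← star_pow, hc, star_one], ?_⟩
  rw [Matrix.conjTranspose_smul, pauliString_conjTranspose]

theorem star_mul_self_of_pow_four {c : ℂ} (hc : c ^ 4 = 1) : star c * c = 1 := by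
  have h : ‖c‖ = 1 := by
    refine (pow_eq_one_iff_of_nonneg (norm_nonneg c) (n := 4) (by norm_num)).1 ?_
    rw [← norm_pow, hc, norm_one]
  rw [Complex.star_def, mul_comm, Complex.mul_conj, Complex.normSq_eq_norm_sq, h]
  norm_num

theorem IsPauli.conjTranspose_mul_self {A : Op ι} (hA : IsPauli A) : Aᴴ * A = 1 := by
  obtain ⟨c, p, hc, rfl⟩ := hA
  rw [Matrix.conjTranspose_smul, pauliString_conjTranspose, smul_mul_smul_comm,
    pauliString_mul_self, star_mul_self_of_pow_four hc, one_smul]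

theorem IsPauli.mul_conjTranspose_self {A : Op ι} (hA : IsPauli A) : A * Aᴴ = 1 := by
  simpa using hA.conjTranspose.conjTranspose_mul_self

/-- Pauli operators that square to the identity. -/
def IsInvolutivePauli (A : Op ι) : Prop := IsPauli A ∧ A * A = 1

theorem smul_pauliString_mul_self (c : ℂ) (p : ι → Pauli) :
    (c • pauliString p) * (c • pauliString p) = (c * c) • 1 := by
  rw [smul_mul_smul_comm, pauliString_mul_self]

theorem IsInvolutivePauli.conjTranspose {A : Op ι} (hA : IsInvolutivePauli A) : Aᴴ = A := by
  calc Aᴴ = Aᴴ * (A * A) := by rw [hA.2, mul_one]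
    _ = A := by rw [← mul_assoc, hA.1.conjTranspose_mul_self, one_mul]

theorem isInvolutivePauli_pauliString (p : ι → Pauli) : IsInvolutivePauli (pauliString p) :=
  ⟨isPauli_pauliString p, pauliString_mul_self p⟩

theorem IsInvolutivePauli.neg {A : Op ι} (hA : IsInvolutivePauli A) : IsInvolutivePauli (-A) :=
  ⟨by simpa using hA.1.smul (c := -1) (by norm_num), by simpa using hA.2⟩

theorem IsInvolutivePauli.mul_of_commute {A B : Op ι} (hA : IsInvolutivePauli A)
    (hB : IsInvolutivePauli B) (h : A * B = B * A) : IsInvolutivePauli (A * B) :=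
  ⟨hA.1.mul hB.1, by
    rw [mul_assoc, ← mul_assoc B, ← h, mul_assoc, hB.2, mul_one, hA.2]⟩

/-- Here `A * B` squares to `-1`; the factor `i` repairs the sign. -/
theorem IsInvolutivePauli.mul_of_anticommute {A B : Op ι} (hA : IsInvolutivePauli A)
    (hB : IsInvolutivePauli B) (h : A * B = -(B * A)) :
    IsInvolutivePauli (Complex.I • (A * B)) :=
  ⟨(hA.1.mul hB.1).smul I_pow_four, by
    have h' : B * A = -(A * B) := by rw [h, neg_neg]
    rw [smul_mul_smul_comm, mul_assoc, ← mul_assoc B, h', neg_mul, mul_assoc A B B, hB.2, mul_one,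
      mul_neg, hA.2]
    simp⟩

/-! ### Pauli rotations -/

/-- The rotation by a quarter turn about a Pauli operator `A`. -/
noncomputable def rot (A : Op ι) : Op ι := ((Real.sqrt 2 : ℂ)⁻¹) • (1 + Complex.I • A)

theorem inv_sqrt_two_mul_self : (Real.sqrt 2 : ℂ)⁻¹ * (Real.sqrt 2 : ℂ)⁻¹ = 1 / 2 := by
  rw [← mul_inv, ← Complex.ofReal_mul, Real.mul_self_sqrt (by norm_num)]
  norm_num

theorem rot_mul_rot_neg {A : Op ι} (h : A * A = 1) : rot A * rot (-A) = 1 := by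
  have : (1 + Complex.I • A) * (1 + Complex.I • (-A)) = (2 : ℂ) • 1 := by
    simp only [mul_add, add_mul, mul_one, one_mul, smul_mul_smul_comm, mul_neg, h, smul_neg,
      Complex.I_mul_I]
    module
  rw [rot, rot, smul_mul_smul_comm, this, smul_smul, inv_sqrt_two_mul_self]
  norm_num

theorem rot_neg_mul_rot {A : Op ι} (h : A * A = 1) : rot (-A) * rot A = 1 := by
  simpa using rot_mul_rot_neg (A := -A) (by simpa using h)

theorem rot_mul_self {A : Op ι} (h : A * A = 1) : rot A * rot A = Complex.I • A := by
  have : (1 + Complex.I • A) * (1 + Complex.I • A) = (2 * Complex.I) • A := by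
    simp only [mul_add, add_mul, mul_one, one_mul, smul_mul_smul_comm, h, Complex.I_mul_I]
    module
  rw [rot, smul_mul_smul_comm, this, smul_smul, inv_sqrt_two_mul_self]
  congr 1
  ring

theorem rot_conjTranspose {A : Op ι} (h : Aᴴ = A) : (rot A)ᴴ = rot (-A) := by
  rw [rot, rot, Matrix.conjTranspose_smul, Matrix.conjTranspose_add, Matrix.conjTranspose_smul, h,
    Matrix.conjTranspose_one]
  simp

theorem commute_rot_of_commute {A B : Op ι} (h : Commute A B) : Commute A (rot B) :=
  ((Commute.one_right A).add_right (h.smul_right _)).smul_right _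

theorem rot_mul_of_anticommute {A B : Op ι} (h : A * B = -(B * A)) :
    rot A * B = B * rot (-A) := by
  simp only [rot, smul_mul_assoc, add_mul, one_mul, h, mul_smul_comm, mul_add, mul_one, mul_neg,
    smul_neg]

/-- On Paulis modulo phases, rotations act as symplectic transvections; this is the nontrivial case.
-/
theorem rot_conj_of_anticommute {A B : Op ι} (hA : A * A = 1) (h : A * B = -(B * A)) :
    rot A * B * rot (-A) = Complex.I • (A * B) := by
  rw [rot_mul_of_anticommute h, mul_assoc, rot_mul_self (by simpa using hA), h, mul_smul_comm,
    mul_neg]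

/-- Two anticommuting involutions are conjugated to each other by a rotation. -/
theorem rot_mul_mul {A B : Op ι} (hA : A * A = 1) (hB : B * B = 1) (h : A * B = -(B * A)) :
    rot (Complex.I • (A * B)) * A = B * rot (Complex.I • (A * B)) := by
  have h' : B * A = -(A * B) := by rw [h, neg_neg]
  simp only [rot, smul_mul_assoc, mul_smul_comm, smul_smul, Complex.I_mul_I, neg_smul, one_smul,
    add_mul, mul_add, one_mul, mul_one, neg_mul, mul_neg]
  rw [mul_assoc A B A, ← mul_assoc B A B, h', mul_neg, neg_mul, ← mul_assoc A A, hA, mul_assoc A B,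
    hB, one_mul, mul_one, neg_neg, neg_neg, add_comm]

theorem onQubits_rot (f : κ ↪ ι) (A : Op κ) : onQubits f (rot A) = rot (onQubits f A) := by
  simp only [rot, onQubits_smul, onQubits_add, onQubits_one]

/-! ### Clifford operators -/

theorem IsClifford.star_mul {U : Op ι} (h : IsClifford U) : Uᴴ * U = 1 :=
  Matrix.mem_unitaryGroup_iff'.1 h.1

theorem IsClifford.mul_star {U : Op ι} (h : IsClifford U) : U * Uᴴ = 1 :=
  Matrix.mem_unitaryGroup_iff.1 h.1

theorem IsClifford.mul {U V : Op ι} (hU : IsClifford U) (hV : IsClifford V) :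
    IsClifford (U * V) := by
  refine ⟨mul_mem hU.1 hV.1, fun B hB => ?_⟩
  have := hU.2 _ (hV.2 B hB)
  rwa [Matrix.conjTranspose_mul, show U * V * B * (Vᴴ * Uᴴ) = U * (V * B * Vᴴ) * Uᴴ by
    simp only [mul_assoc]]

theorem isClifford_smul_one {c : ℂ} (hc : star c * c = 1) : IsClifford (c • (1 : Op ι)) := by
  refine ⟨?_, fun B hB => ?_⟩
  · rw [Matrix.mem_unitaryGroup_iff']
    rw [star_smul, star_one, smul_mul_smul_comm, hc, one_smul, mul_one]
  · rw [Matrix.conjTranspose_smul, Matrix.conjTranspose_one, smul_mul_assoc, one_mul,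
      smul_mul_smul_comm, mul_one, mul_comm, hc, one_smul]
    exact hB

theorem isClifford_one : IsClifford (1 : Op ι) := by
  simpa using isClifford_smul_one (ι := ι) (c := 1) (by simp)

theorem isClifford_list_prod {L : List (Op ι)} (h : ∀ G ∈ L, IsClifford G) :
    IsClifford L.prod := by
  induction L with
  | nil => exact isClifford_one
  | cons G L ih =>
    rw [List.prod_cons]
    exact (h G (by simp)).mul (ih fun H hH => h H (by simp [hH]))

theorem IsInvolutivePauli.isClifford_rot {A : Op ι} (hA : IsInvolutivePauli A) :
    IsClifford (rot A) := by
  have hs := rot_conjTranspose hA.conjTranspose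
  refine ⟨?_, fun B hB => ?_⟩
  · rw [Matrix.mem_unitaryGroup_iff, Matrix.star_eq_conjTranspose, hs, rot_mul_rot_neg hA.2]
  · rw [hs]
    rcases hA.1.mul_comm hB with h | h
    · have : Commute B (rot A) := commute_rot_of_commute (Eq.symm h)
      rw [← this.eq, mul_assoc, rot_mul_rot_neg hA.2, mul_one]
      exact hB
    · rw [rot_conj_of_anticommute hA.2 h]
      exact (hA.1.mul hB).smul I_pow_four

/-! ### Gate counts -/

/-- The operator `A` is a product of at most `N` one- and two-qubit Clifford gates. -/
def HasCost (N : ℕ) (A : Op ι) : Prop :=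
  ∃ L : List (Op ι), (∀ G ∈ L, IsOneOrTwoQubitClifford G ∧ IsClifford G) ∧ L.length ≤ N ∧ A = L.prod

theorem HasCost.mono {M N : ℕ} {A : Op ι} (h : HasCost M A) (hMN : M ≤ N) : HasCost N A := by
  obtain ⟨L, hL, hlen, rfl⟩ := h
  exact ⟨L, hL, hlen.trans hMN, rfl⟩

theorem hasCost_one : HasCost 0 (1 : Op ι) := ⟨[], by simp, by simp, by simp⟩

theorem HasCost.mul {M N : ℕ} {A B : Op ι} (hA : HasCost M A) (hB : HasCost N B) :
    HasCost (M + N) (A * B) := by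
  obtain ⟨L, hL, hlen, rfl⟩ := hA
  obtain ⟨L', hL', hlen', rfl⟩ := hB
  refine ⟨L ++ L', fun G hG => ?_, by rw [List.length_append]; omega, by rw [List.prod_append]⟩
  rcases List.mem_append.1 hG with h | h
  exacts [hL G h, hL' G h]

theorem hasCost_list_prod {N : ℕ} {L : List (Op ι)} (h : ∀ A ∈ L, HasCost N A) :
    HasCost (L.length * N) L.prod := by
  induction L with
  | nil => simpa using hasCost_one
  | cons G L ih =>
    rw [List.prod_cons, List.length_cons]
    exact ((h G (by simp)).mul (ih fun H hH => h H (by simp [hH]))).mono (by rw [add_mul]; omega)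

theorem hasCost_smul_one [Nonempty ι] {c : ℂ} (hc : star c * c = 1) :
    HasCost 1 (c • (1 : Op ι)) := by
  refine ⟨[c • 1], ?_, by simp, by simp⟩
  simp only [List.mem_singleton, forall_eq]
  refine ⟨⟨1, ⟨fun _ => Classical.arbitrary ι, fun _ _ _ => Subsingleton.elim _ _⟩, c • 1,
    Or.inl rfl, isClifford_smul_one hc, ?_⟩, isClifford_smul_one hc⟩
  rw [onQubits_smul, onQubits_one]

theorem HasCost.smul [Nonempty ι] {N : ℕ} {A : Op ι} (h : HasCost N A) {c : ℂ}
    (hc : star c * c = 1) : HasCost (N + 1) (c • A) := by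
  have := (hasCost_smul_one (ι := ι) hc).mul h
  rw [smul_mul_assoc, one_mul, add_comm] at this
  exact this

theorem hasCost_rot_of_card_le_two [Nonempty ι] {T : Finset ι} (hT : T.card ≤ 2) {A : Op ι}
    (h : PauliOn T A) (hA : A * A = 1) : HasCost 1 (rot A) := by
  -- A gate must act on one or two qubits, so an empty support is padded by an arbitrary qubit.
  obtain ⟨S, hTS, hS⟩ : ∃ S : Finset ι, T ⊆ S ∧ (S.card = 1 ∨ S.card = 2) := by
    rcases T.eq_empty_or_nonempty with rfl | hne
    · exact ⟨{Classical.arbitrary ι}, by simp, by simp⟩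
    · have := hne.card_pos
      exact ⟨T, subset_rfl, by omega⟩
  -- `HasCost` records Cliffordness on the full register as well as on the small one, so that
  -- products of gates are visibly Clifford.
  have hcl : IsClifford (rot A) := IsInvolutivePauli.isClifford_rot ⟨h.isPauli, hA⟩
  obtain ⟨c, p, hc, hp, rfl⟩ := h
  let f : Fin S.card ↪ ι := S.equivFin.symm.toEmbedding.trans (Function.Embedding.subtype _)
  have hf : ∀ i, i ∈ Set.range f ↔ i ∈ S := by
    intro i
    constructor
    · rintro ⟨j, rfl⟩
      exact (S.equivFin.symm j).2
    · intro hi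
      exact ⟨S.equivFin ⟨i, hi⟩, by simp [f]⟩
  have hA' : c • pauliString p = onQubits f (c • pauliString (p ∘ f)) := by
    rw [onQubits_smul, onQubits_pauliString]
    congr 2
    ext1 i
    by_cases hi : i ∈ Set.range f
    · obtain ⟨j, rfl⟩ := hi
      rw [f.injective.extend_apply, Function.comp]
    · rw [Function.extend_apply' _ _ _ hi, hp i fun h => hi ((hf i).2 (hTS h))]
  refine ⟨[rot (c • pauliString p)], ?_, by simp, by simp⟩
  simp only [List.mem_singleton, forall_eq]
  refine ⟨⟨S.card, f, rot (c • pauliString (p ∘ f)), hS, ?_, ?_⟩, hcl⟩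
  · refine IsInvolutivePauli.isClifford_rot ⟨(isPauli_pauliString _).smul hc, ?_⟩
    apply onQubits_injective f
    rw [onQubits_mul, ← hA', hA, onQubits_one]
  · rw [onQubits_rot, ← hA']

/-- The Pauli operator `σ` on the qubit `i`. -/
def onQubit (i : ι) (σ : Pauli) : Op ι := pauliString (Function.update (fun _ => .I) i σ)

theorem pauliOn_onQubit (i : ι) (σ : Pauli) : PauliOn {i} (onQubit i σ) :=
  ⟨1, _, by simp, fun j hj => Function.update_of_ne (by simpa using hj) _ _, by
    rw [one_smul, onQubit]⟩

theorem isInvolutivePauli_onQubit (i : ι) (σ : Pauli) : IsInvolutivePauli (onQubit i σ) :=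
  isInvolutivePauli_pauliString _

theorem onQubit_mul_pauliString (i : ι) (σ : Pauli) (p : ι → Pauli) :
    onQubit i σ * pauliString p = σ.sign (p i) • (pauliString p * onQubit i σ) := by
  rw [onQubit, pauliString_mul_comm]
  congr 1
  rw [Fintype.prod_eq_single i]
  · simp
  · intro j hj
    rw [Function.update_of_ne hj]
    cases p j <;> rfl

/-- A rotation about a Pauli operator of weight `w` is a product of few gates. -/
theorem hasCost_rot [Nonempty ι] (w : ℕ) {T : Finset ι} (hT : T.card ≤ w) {A : Op ι}
    (h : PauliOn T A) (hA : A * A = 1) : HasCost (2 * w + 1) (rot A) := by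
  induction w generalizing T A with
  | zero => exact (hasCost_rot_of_card_le_two (by omega) h hA).mono (by omega)
  | succ w ih =>
    by_cases h2 : T.card ≤ 2
    · exact (hasCost_rot_of_card_le_two h2 h hA).mono (by omega)
    obtain ⟨c, p, hc, hp, rfl⟩ := h
    by_cases hI : ∃ a ∈ T, p a = .I
    · obtain ⟨a, ha, hpa⟩ := hI
      refine (ih (T := T.erase a) (by rw [Finset.card_erase_of_mem ha]; omega)
        ⟨c, p, hc, fun i hi => ?_, rfl⟩ hA).mono (by omega)
      by_cases hia : i = a
      · rw [hia, hpa]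
      · exact hp i fun h => hi (Finset.mem_erase.2 ⟨hia, h⟩)
    push Not at hI
    obtain ⟨a, ha, b, hb, hab⟩ := Finset.one_lt_card.1 (show 1 < T.card by omega)
    obtain ⟨τ, hτ⟩ := Pauli.exists_anticommuting (hI b hb)
    -- A two-qubit string that agrees with `p` at `a` and anticommutes with it at `b`. Its product
    -- with `p` is trivial at `a`, and conjugating by its rotation trades `p` for that product, of
    -- smaller support, at the cost of two gates.
    set q : ι → Pauli := Function.update (Function.update (fun _ => .I) a (p a)) b τ with hq
    have hqa : q a = p a := by rw [hq, Function.update_of_ne hab, Function.update_self]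
    have hqb : q b = τ := by rw [hq, Function.update_self]
    have hqi : ∀ i, i ≠ a → i ≠ b → q i = .I := fun i h1 h2 => by
      rw [hq, Function.update_of_ne h2, Function.update_of_ne h1]
    have hanti : pauliString q * (c • pauliString p) = -((c • pauliString p) * pauliString q) := by
      rw [mul_smul_comm, pauliString_mul_comm, Fintype.prod_eq_single b, hqb, hτ, smul_mul_assoc,
        neg_smul, one_smul, smul_neg]
      intro i hi
      by_cases hia : i = a
      · rw [hia, hqa]; cases p a <;> rfl
      · rw [hqi i hia hi]; cases p i <;> rfl
    have hinv : IsInvolutivePauli (c • pauliString p) := ⟨(isPauli_pauliString p).smul hc, hA⟩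
    have hB := ((isInvolutivePauli_pauliString q).mul_of_anticommute hinv hanti).neg
    set B := -(Complex.I • (pauliString q * (c • pauliString p))) with hBdef
    have hBT : PauliOn (T.erase a) B := by
      refine ⟨-Complex.I * c * ∏ i, (q i).phase (p i), fun i => (q i).mul (p i), ?_, ?_, ?_⟩
      · rw [mul_pow, mul_pow, prod_phase_pow, hc, Even.neg_pow (by decide : Even 4), I_pow_four]
        norm_num
      · intro i hi
        by_cases hia : i = a
        · simp only [hia, hqa, Pauli.mul_self]
        · have hiT : i ∉ T := fun h => hi (Finset.mem_erase.2 ⟨hia, h⟩)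
          simp only [hqi i hia (fun h => hiT (h ▸ hb)), hp i hiT, Pauli.mul_self]
      · rw [hBdef, mul_smul_comm, pauliString_mul]
        module
    have hqq := pauliString_mul_self q
    have hqB : pauliString q * B = -(B * pauliString q) := by
      have hanti' : (c • pauliString p) * pauliString q = -(pauliString q * (c • pauliString p)) := by
        rw [hanti, neg_neg]
      rw [hBdef, mul_neg, neg_mul, mul_smul_comm, smul_mul_assoc, mul_assoc (pauliString q) _
        (pauliString q), hanti', mul_neg, smul_neg, neg_neg]
    have hconj : rot (pauliString q) * B * rot (-pauliString q) = c • pauliString p := by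
      rw [rot_conj_of_anticommute hqq hqB, hBdef, mul_neg, mul_smul_comm, ← mul_assoc, hqq, one_mul,
        smul_neg, smul_smul, Complex.I_mul_I]
      simp
    have key : rot (c • pauliString p) = rot (pauliString q) * rot B * rot (-pauliString q) := by
      rw [← hconj, rot, rot.eq_1 B, mul_smul_comm, smul_mul_assoc, mul_add, add_mul, mul_one,
        rot_mul_rot_neg hqq, mul_smul_comm, smul_mul_assoc]
    have hqT : ∀ d : ℂ, d ^ 4 = 1 → PauliOn {a, b} (d • pauliString q) := fun d hd =>
      ⟨d, q, hd, fun i hi => hqi i (fun h => hi (by simp [h])) (fun h => hi (by simp [h])), rfl⟩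
    have hcard : ({a, b} : Finset ι).card ≤ 2 := Finset.card_le_two
    have h1 := hasCost_rot_of_card_le_two hcard (by simpa using hqT 1 (by norm_num)) hqq
    have h3 := hasCost_rot_of_card_le_two hcard (by simpa using hqT (-1) (by norm_num))
      (A := -pauliString q) (by simpa using hqq)
    rw [key]
    exact ((h1.mul (ih (by rw [Finset.card_erase_of_mem ha]; omega) hBT hB.2)).mul h3).mono
      (by omega)

/-- A Pauli operator of weight `w` is a product of few gates. -/
theorem PauliOn.hasCost [Nonempty ι] {w : ℕ} {T : Finset ι} (hT : T.card ≤ w) {A : Op ι}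
    (h : PauliOn T A) : HasCost (4 * w + 3) A := by
  obtain ⟨c, p, hc, hp, rfl⟩ := h
  have hpp := pauliString_mul_self p
  -- Two quarter turns about the string give `i` times the string; the scalar `-i * c` corrects the
  -- phase.
  have h1 := hasCost_rot w hT ⟨1, p, by simp, hp, by simp⟩ hpp
  have h2 := (h1.mul h1).smul (c := -Complex.I * c) (by
    apply star_mul_self_of_pow_four
    rw [mul_pow, hc, Even.neg_pow (by decide : Even 4), I_pow_four, one_mul])
  rw [rot_mul_self hpp, smul_smul, show -Complex.I * c * Complex.I = c by
    linear_combination (-c) * Complex.I_mul_I] at h2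
  exact h2.mono (by omega)

end PauliOperators

/-! ### Generation of the Clifford group by rotations -/

section Generation

variable {ι κ : Type} [Fintype ι] [DecidableEq ι] [Fintype κ] [DecidableEq κ]

/-- Products of at most `N` Pauli rotations. -/
def IsRotProd (N : ℕ) (R : Op κ) : Prop :=
  ∃ L : List (Op κ), (∀ A ∈ L, IsInvolutivePauli A) ∧ L.length ≤ N ∧ R = (L.map rot).prod

theorem isRotProd_one : IsRotProd 0 (1 : Op κ) := ⟨[], by simp, by simp, by simp⟩

theorem IsInvolutivePauli.isRotProd {A : Op κ} (hA : IsInvolutivePauli A) :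
    IsRotProd 1 (rot A) := ⟨[A], by simpa using hA, by simp, by simp⟩

theorem IsRotProd.mul {M N : ℕ} {A B : Op κ} (hA : IsRotProd M A) (hB : IsRotProd N B) :
    IsRotProd (M + N) (A * B) := by
  obtain ⟨L, hL, hlen, rfl⟩ := hA
  obtain ⟨L', hL', hlen', rfl⟩ := hB
  refine ⟨L ++ L', fun G hG => ?_, by rw [List.length_append]; omega,
    by rw [List.map_append, List.prod_append]⟩
  rcases List.mem_append.1 hG with h | h
  exacts [hL G h, hL' G h]

theorem IsRotProd.mono {M N : ℕ} {A : Op κ} (hA : IsRotProd M A) (h : M ≤ N) : IsRotProd N A := by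
  obtain ⟨L, hL, hlen, rfl⟩ := hA
  exact ⟨L, hL, hlen.trans h, rfl⟩

theorem IsRotProd.isClifford {N : ℕ} {R : Op κ} (h : IsRotProd N R) : IsClifford R := by
  obtain ⟨L, hL, -, rfl⟩ := h
  refine isClifford_list_prod fun G hG => ?_
  obtain ⟨A, hA, rfl⟩ := List.mem_map.1 hG
  exact (hL A hA).isClifford_rot

/-- `B` satisfies the same commutation relation with `T` as `A`. -/
def SameSign (T A B : Op κ) : Prop :=
  (T * A = A * T ∧ T * B = B * T) ∨ (T * A = -(A * T) ∧ T * B = -(B * T))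

theorem SameSign.commute_mul {T A B : Op κ} (h : SameSign T A B) : Commute T (A * B) := by
  rw [commute_iff_eq]
  rcases h with ⟨h1, h2⟩ | ⟨h1, h2⟩
  · rw [← mul_assoc, h1, mul_assoc, h2, mul_assoc]
  · rw [← mul_assoc, h1, neg_mul, mul_assoc, h2, mul_neg, neg_neg, mul_assoc]

/-- The rotation is about `i * A * B`. If `T` has the same sign with `A` and `B`, the two signs
cancel in the product, so `T` is left alone. The inverse is the rotation about the opposite
operator. -/
theorem exists_rot_of_anticommute {A B : Op κ} (hA : IsInvolutivePauli A)
    (hB : IsInvolutivePauli B) (h : A * B = -(B * A)) :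
    ∃ R R', IsRotProd 1 R ∧ IsRotProd 1 R' ∧ R' * R = 1 ∧ R * A = B * R ∧
      ∀ T, SameSign T A B → Commute T R := by
  have hC := hA.mul_of_anticommute hB h
  exact ⟨_, _, hC.isRotProd, hC.neg.isRotProd, rot_neg_mul_rot hC.2, rot_mul_mul hA.2 hB.2 h,
    fun T hT => commute_rot_of_commute (hT.commute_mul.smul_right _)⟩

/-- When `A` and `B` commute, no single rotation of the previous kind is available; the detour goes
through a common anticommuting `C`. -/
theorem exists_rot_of_anticommute_both {A B C : Op κ} (hA : IsInvolutivePauli A)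
    (hB : IsInvolutivePauli B) (hC : IsInvolutivePauli C) (h : A * C = -(C * A))
    (h' : C * B = -(B * C)) :
    ∃ R R', IsRotProd 2 R ∧ IsRotProd 2 R' ∧ R' * R = 1 ∧ R * A = B * R ∧
      ∀ T, SameSign T A C → SameSign T C B → Commute T R := by
  obtain ⟨R, R', h1, h2, h3, h4, h5⟩ := exists_rot_of_anticommute hA hC h
  obtain ⟨S, S', k1, k2, k3, k4, k5⟩ := exists_rot_of_anticommute hC hB h'
  refine ⟨S * R, R' * S', k1.mul h1, h2.mul k2, ?_, ?_, fun T hT hT' => (k5 T hT').mul_right (h5 T hT)⟩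
  · rw [mul_assoc, ← mul_assoc S', k3, one_mul, h3]
  · rw [mul_assoc, h4, ← mul_assoc, k4, mul_assoc]

theorem IsClifford.conj_isInvolutivePauli {U A : Op κ} (hU : IsClifford U)
    (hA : IsInvolutivePauli A) : IsInvolutivePauli (U * A * Uᴴ) := by
  refine ⟨hU.2 A hA.1, ?_⟩
  calc U * A * Uᴴ * (U * A * Uᴴ) = U * A * (Uᴴ * U) * A * Uᴴ := by simp only [mul_assoc]
    _ = U * (A * A) * Uᴴ := by rw [hU.star_mul]; simp only [mul_assoc, one_mul]
    _ = 1 := by rw [hA.2, mul_one, hU.mul_star]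

theorem IsClifford.conj_mul_conj {U : Op κ} (hU : IsClifford U) (A B : Op κ) :
    U * A * Uᴴ * (U * B * Uᴴ) = U * (A * B) * Uᴴ := by
  calc U * A * Uᴴ * (U * B * Uᴴ) = U * A * (Uᴴ * U) * B * Uᴴ := by simp only [mul_assoc]
    _ = _ := by rw [hU.star_mul]; simp only [mul_assoc, one_mul]

theorem IsClifford.conj_mul {U : Op κ} (hU : IsClifford U) (A : Op κ) :
    U * A * Uᴴ * U = U * A := by
  rw [mul_assoc, hU.star_mul, mul_one]

theorem IsClifford.conj_eq_of_commute {U : Op κ} (hU : IsClifford U) {A : Op κ}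
    (h : Commute U A) : U * A * Uᴴ = A := by
  rw [h.eq, mul_assoc, hU.mul_star, mul_one]

/-- A Clifford that commutes with the Pauli operators in `𝒯` can be multiplied by few rotations so
that it also commutes with a pair of anticommuting Pauli operators `X` and `Z`. -/
theorem IsClifford.exists_rot_commute {U X Z : Op κ} (hU : IsClifford U)
    (hX : IsInvolutivePauli X) (hZ : IsInvolutivePauli Z) (hXZ : X * Z = -(Z * X))
    {𝒯 : Set (Op κ)} (hT : ∀ T ∈ 𝒯, Commute U T) (hTX : ∀ T ∈ 𝒯, Commute T X)
    (hTZ : ∀ T ∈ 𝒯, Commute T Z) :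
    ∃ R U', IsRotProd 4 R ∧ IsClifford U' ∧ U = R * U' ∧ (∀ T ∈ 𝒯, Commute U' T) ∧
      Commute U' X ∧ Commute U' Z := by
  have hZX : Z * X = -(X * Z) := by rw [hXZ, neg_neg]
  have conjT : ∀ W : Op κ, IsClifford W → (∀ T ∈ 𝒯, Commute W T) → ∀ Y, (∀ T ∈ 𝒯, Commute T Y) →
      ∀ T ∈ 𝒯, Commute T (W * Y * Wᴴ) := by
    intro W hW hWT Y hY T hTm
    have := hW.conj_mul_conj T Y
    have h2 := hW.conj_mul_conj Y T
    rw [hW.conj_eq_of_commute (hWT T hTm)] at this h2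
    rw [commute_iff_eq, this, h2, (hY T hTm).eq]
  -- This is transitivity of transvections on hyperbolic pairs. First the image of `X` is moved back
  -- to `X`, within the commutant of `𝒯`.
  have step1 : ∃ R R', IsRotProd 2 R ∧ IsRotProd 2 R' ∧ R' * R = 1 ∧
      R * (U * X * Uᴴ) = X * R ∧ ∀ T ∈ 𝒯, Commute T R := by
    have hA := hU.conj_isInvolutivePauli hX
    have hB := hU.conj_isInvolutivePauli hZ
    have hAT := conjT U hU hT X hTX
    have hBT := conjT U hU hT Z hTZ
    have hAB : (U * X * Uᴴ) * (U * Z * Uᴴ) = -((U * Z * Uᴴ) * (U * X * Uᴴ)) := by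
      rw [hU.conj_mul_conj, hU.conj_mul_conj, hXZ, mul_neg, neg_mul]
    set A := U * X * Uᴴ
    set B := U * Z * Uᴴ
    rcases hA.1.mul_comm hX.1 with h | h
    swap
    · obtain ⟨R, R', h1, h2, h3, h4, h5⟩ := exists_rot_of_anticommute hA hX h
      exact ⟨R, R', h1.mono (by omega), h2.mono (by omega), h3, h4,
        fun T hTm => h5 T (Or.inl ⟨hAT T hTm, hTX T hTm⟩)⟩
    -- A common anticommuting partner of `A` and `X`: `Z` anticommutes with `X`, and `B` with `A`.
    -- If neither serves for both, `Z` commutes with `A` and `B` with `X`, so `Z * B` does, up to a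
    -- phase.
    · obtain ⟨C, hC, hAC, hCX, hTC⟩ : ∃ C, IsInvolutivePauli C ∧ A * C = -(C * A) ∧
          C * X = -(X * C) ∧ ∀ T ∈ 𝒯, Commute T C := by
        rcases hA.1.mul_comm hZ.1 with h1 | h1
        swap
        · exact ⟨Z, hZ, h1, hZX, hTZ⟩
        rcases hB.1.mul_comm hX.1 with h2 | h2
        swap
        · exact ⟨B, hB, hAB, h2, hBT⟩
        have e1 : A * (Z * B) = -(Z * B * A) := by
          rw [← mul_assoc, h1, mul_assoc Z A B, hAB, mul_neg, mul_assoc Z B A]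
        have e2 : Z * B * X = -(X * (Z * B)) := by
          rw [mul_assoc, h2, ← mul_assoc, hZX, neg_mul, mul_assoc]
        rcases hZ.1.mul_comm hB.1 with h3 | h3
        · exact ⟨Z * B, hZ.mul_of_commute hB h3, e1, e2,
            fun T hTm => (hTZ T hTm).mul_right (hBT T hTm)⟩
        · refine ⟨_, hZ.mul_of_anticommute hB h3, ?_, ?_,
            fun T hTm => ((hTZ T hTm).mul_right (hBT T hTm)).smul_right _⟩
          · rw [mul_smul_comm, e1, smul_neg, smul_mul_assoc]
          · rw [mul_smul_comm, ← smul_neg, ← e2, smul_mul_assoc]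
      obtain ⟨R, R', h1, h2, h3, h4, h5⟩ := exists_rot_of_anticommute_both hA hX hC hAC hCX
      exact ⟨R, R', h1, h2, h3, h4, fun T hTm => h5 T (Or.inl ⟨hAT T hTm, hTC T hTm⟩)
        (Or.inl ⟨hTC T hTm, hTX T hTm⟩)⟩
  obtain ⟨R, R', hR, hR', hRR, hRX, hRT⟩ := step1
  have hU1 := hR.isClifford.mul hU
  have hU1X : Commute (R * U) X := by
    rw [commute_iff_eq, mul_assoc, ← hU.conj_mul, ← mul_assoc, hRX, mul_assoc]
  have hU1T : ∀ T ∈ 𝒯, Commute (R * U) T := fun T hTm => ((hRT T hTm).symm).mul_left (hT T hTm)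
  have hUR : U = R' * (R * U) := by rw [← mul_assoc, hRR, one_mul]
  set U1 := R * U
  -- Now `X` is fixed and must stay so. The image of `Z` and `Z` itself both anticommute with `X`,
  -- so the signs agree; if a detour is needed it goes through `i * X * Z`, which also anticommutes
  -- with `X`.
  have step2 : ∃ S S', IsRotProd 2 S ∧ IsRotProd 2 S' ∧ S' * S = 1 ∧
      S * (U1 * Z * U1ᴴ) = Z * S ∧ Commute X S ∧ ∀ T ∈ 𝒯, Commute T S := by
    have hA := hU1.conj_isInvolutivePauli hZ
    have hAT := conjT U1 hU1 hU1T Z hTZ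
    have hXA : X * (U1 * Z * U1ᴴ) = -((U1 * Z * U1ᴴ) * X) := by
      have h1 := hU1.conj_mul_conj X Z
      have h2 := hU1.conj_mul_conj Z X
      rw [hU1.conj_eq_of_commute hU1X] at h1 h2
      rw [h1, h2, hXZ, mul_neg, neg_mul]
    set A := U1 * Z * U1ᴴ
    have hAX : A * X = -(X * A) := by rw [hXA, neg_neg]
    rcases hA.1.mul_comm hZ.1 with h | h
    swap
    · obtain ⟨S, S', h1, h2, h3, h4, h5⟩ := exists_rot_of_anticommute hA hZ h
      exact ⟨S, S', h1.mono (by omega), h2.mono (by omega), h3, h4, h5 X (Or.inr ⟨hXA, hXZ⟩),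
        fun T hTm => h5 T (Or.inl ⟨hAT T hTm, hTZ T hTm⟩)⟩
    · have hY := hX.mul_of_anticommute hZ hXZ
      have hAY : A * (X * Z) = -(X * Z * A) := by
        rw [← mul_assoc, hAX, neg_mul, mul_assoc, h, mul_assoc]
      have hYZ : X * Z * Z = -(Z * (X * Z)) := by
        rw [← mul_assoc, hZX, neg_mul, neg_neg]
      have hXY : X * (X * Z) = -(X * Z * X) := by
        rw [mul_assoc X Z X, hZX, mul_neg, neg_neg]
      obtain ⟨S, S', h1, h2, h3, h4, h5⟩ := exists_rot_of_anticommute_both hA hZ hY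
        (by rw [mul_smul_comm, hAY, smul_neg, smul_mul_assoc])
        (by rw [mul_smul_comm, ← smul_neg, ← hYZ, smul_mul_assoc])
      have hXY' : X * (Complex.I • (X * Z)) = -(Complex.I • (X * Z) * X) := by
        rw [mul_smul_comm, hXY, smul_neg, smul_mul_assoc]
      have hTY : ∀ T ∈ 𝒯, Commute T (Complex.I • (X * Z)) := fun T hTm =>
        ((hTX T hTm).mul_right (hTZ T hTm)).smul_right _
      exact ⟨S, S', h1, h2, h3, h4, h5 X (Or.inr ⟨hXA, hXY'⟩) (Or.inr ⟨hXY', hXZ⟩),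
        fun T hTm => h5 T (Or.inl ⟨hAT T hTm, hTY T hTm⟩) (Or.inl ⟨hTY T hTm, hTZ T hTm⟩)⟩
  obtain ⟨S, S', hS, hS', hSS, hSZ, hSX, hST⟩ := step2
  refine ⟨R' * S', S * U1, hR'.mul hS', hS.isClifford.mul hU1, ?_,
    fun T hTm => (hST T hTm).symm.mul_left (hU1T T hTm), hSX.symm.mul_left hU1X, ?_⟩
  · rw [hUR, mul_assoc, ← mul_assoc S', hSS, one_mul]
  · rw [commute_iff_eq, mul_assoc, ← hU1.conj_mul, ← mul_assoc, hSZ, mul_assoc]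

theorem onQubit_I (i : κ) : onQubit i .I = 1 := by
  rw [onQubit, Function.update_eq_self, pauliString_I]

theorem onQubit_Y (i : κ) : onQubit i .Y = Complex.I • (onQubit i .X * onQubit i .Z) := by
  rw [onQubit, onQubit, onQubit, pauliString_mul, Fintype.prod_eq_single i]
  · simp only [Function.update_self, Pauli.phase, smul_smul, mul_neg, Complex.I_mul_I, neg_neg,
      one_smul]
    congr 1
    ext1 j
    by_cases hj : j = i
    · subst hj; simp [Pauli.mul]
    · simp [hj, Pauli.mul]
  · intro j hj
    simp [hj, Pauli.phase]

theorem onQubit_mul_onQubit_of_ne {i j : κ} (h : i ≠ j) (σ τ : Pauli) :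
    Commute (onQubit i σ) (onQubit j τ) := by
  rw [commute_iff_eq, onQubit.eq_1 j, onQubit_mul_pauliString, Function.update_of_ne h]
  cases σ <;> simp [Pauli.sign]

theorem onQubit_X_mul_Z (i : κ) :
    onQubit i .X * onQubit i .Z = -(onQubit i .Z * onQubit i .X) := by
  rw [onQubit.eq_1 i .Z, onQubit_mul_pauliString, Function.update_self]
  simp [Pauli.sign]

/-- Pauli strings are products of single-qubit Pauli operators. -/
theorem pauliString_eq_mul (p : κ → Pauli) (i : κ) :
    pauliString p = onQubit i (p i) * pauliString (Function.update p i .I) := by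
  rw [onQubit, pauliString_mul, Finset.prod_eq_one]
  · rw [one_smul]
    congr 1
    ext1 j
    by_cases hj : j = i
    · subst hj; cases h : p j <;> simp [Pauli.mul]
    · simp [hj, Pauli.mul]
  · intro j _
    by_cases hj : j = i
    · subst hj; cases h : p j <;> simp [Pauli.phase]
    · simp only [Function.update_of_ne hj]; cases p j <;> rfl

theorem pauliString_eq_list_prod (T : Finset κ) (p : κ → Pauli) (hp : ∀ i, i ∉ T → p i = .I) :
    ∃ L : List (κ × Pauli), L.length ≤ T.card ∧
      pauliString p = (L.map fun a => onQubit a.1 a.2).prod := by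
  induction T using Finset.induction_on generalizing p with
  | empty =>
    refine ⟨[], by simp, ?_⟩
    rw [List.map_nil, List.prod_nil, ← pauliString_I]
    congr 1
    exact funext fun i => hp i (by simp)
  | insert a T ha ih =>
    obtain ⟨L, hL, h⟩ := ih (Function.update p a .I) fun i hi => by
      by_cases hia : i = a
      · rw [hia, Function.update_self]
      · rw [Function.update_of_ne hia, hp i (by simp [hia, hi])]
    refine ⟨(a, p a) :: L, by rw [Finset.card_insert_of_notMem ha, List.length_cons]; omega, ?_⟩
    rw [List.map_cons, List.prod_cons, ← h]
    exact pauliString_eq_mul p a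

theorem commute_pauliString_of_forall {U : Op κ} (hX : ∀ i, Commute U (onQubit i .X))
    (hZ : ∀ i, Commute U (onQubit i .Z)) (p : κ → Pauli) : Commute U (pauliString p) := by
  obtain ⟨L, -, h⟩ := pauliString_eq_list_prod Finset.univ p (by simp)
  rw [h]
  refine Commute.list_prod_right _ _ fun B hB => ?_
  obtain ⟨⟨i, σ⟩, -, rfl⟩ := List.mem_map.1 hB
  cases σ
  · simp only [onQubit_I]; exact Commute.one_right _
  · exact hX i
  · simp only [onQubit_Y]; exact ((hX i).mul_right (hZ i)).smul_right _
  · exact hZ i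

/-- Every Clifford operator is a product of Pauli rotations, up to a scalar. -/
theorem IsClifford.eq_smul_isRotProd {V : Op κ} (hV : IsClifford V) :
    ∃ (c : ℂ) (R : Op κ), star c * c = 1 ∧ IsRotProd (4 * Fintype.card κ) R ∧ V = c • R := by
  -- Qubit by qubit, four rotations are split off until the remainder commutes with all single-qubit
  -- Paulis and is therefore scalar.
  have key : ∀ S : Finset κ, ∃ R U, IsRotProd (4 * S.card) R ∧ IsClifford U ∧ V = R * U ∧
      ∀ i ∈ S, Commute U (onQubit i .X) ∧ Commute U (onQubit i .Z) := by
    intro S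
    induction S using Finset.induction_on with
    | empty => exact ⟨1, V, isRotProd_one, hV, by simp, by simp⟩
    | insert a S ha ih =>
      obtain ⟨R, U, hR, hU, hRU, hS⟩ := ih
      have hne : ∀ i ∈ S, i ≠ a := fun i hi h => ha (h ▸ hi)
      obtain ⟨R', U', hR', hU', hRU', hT, hX, hZ⟩ := hU.exists_rot_commute
        (isInvolutivePauli_onQubit a .X) (isInvolutivePauli_onQubit a .Z) (onQubit_X_mul_Z a)
        (𝒯 := {T | ∃ i ∈ S, T = onQubit i .X ∨ T = onQubit i .Z})
        (by rintro T ⟨i, hi, rfl | rfl⟩; exacts [(hS i hi).1, (hS i hi).2])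
        (by rintro T ⟨i, hi, rfl | rfl⟩ <;> exact onQubit_mul_onQubit_of_ne (hne i hi) _ _)
        (by rintro T ⟨i, hi, rfl | rfl⟩ <;> exact onQubit_mul_onQubit_of_ne (hne i hi) _ _)
      refine ⟨R * R', U', (hR.mul hR').mono ?_, hU', by rw [mul_assoc, ← hRU', hRU], ?_⟩
      · rw [Finset.card_insert_of_notMem ha]; omega
      · intro i hi
        rcases Finset.mem_insert.1 hi with rfl | hi
        · exact ⟨hX, hZ⟩
        · exact ⟨hT _ ⟨i, hi, Or.inl rfl⟩, hT _ ⟨i, hi, Or.inr rfl⟩⟩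
  obtain ⟨R, U, hR, hU, hRU, hS⟩ := key Finset.univ
  obtain ⟨c, rfl⟩ := eq_smul_one_of_commute fun p => (commute_pauliString_of_forall
    (fun i => (hS i (Finset.mem_univ i)).1) (fun i => (hS i (Finset.mem_univ i)).2) p).symm
  refine ⟨c, R, ?_, hR, by rw [hRU, mul_smul_comm, mul_one]⟩
  apply smul_one_injective (ι := κ)
  have := hU.star_mul
  rwa [Matrix.conjTranspose_smul, Matrix.conjTranspose_one, smul_mul_smul_comm, mul_one,
    ← one_smul ℂ (1 : Op κ), smul_smul, mul_one] at this

/-- A Clifford operator on few qubits of the register is a product of few gates. -/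
theorem IsClifford.hasCost_onQubits [Nonempty ι] {V : Op κ} (hV : IsClifford V) (f : κ ↪ ι) {k : ℕ}
    (hk : Fintype.card κ ≤ k) : HasCost (4 * k * (2 * k + 1) + 1) (onQubits f V) := by
  obtain ⟨c, R, hc, ⟨L, hL, hlen, rfl⟩, rfl⟩ := hV.eq_smul_isRotProd
  rw [onQubits_smul, ← onQubitsHom_apply, map_list_prod]
  refine HasCost.smul ((hasCost_list_prod (N := 2 * k + 1) ?_).mono ?_) hc
  · intro G hG
    simp only [List.mem_map, exists_exists_and_eq_and] at hG
    obtain ⟨A, hA, rfl⟩ := hG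
    rw [onQubitsHom_apply, onQubits_rot]
    refine hasCost_rot k ?_ (hL A hA).1.pauliOn.onQubits ?_
    · rwa [Finset.card_map]
    · rw [← onQubits_mul, (hL A hA).2, onQubits_one]
  · simp only [List.length_map]
    exact Nat.mul_le_mul_right _ (hlen.trans (Nat.mul_le_mul_left 4 hk))

end Generation

/-! ### Operators that are diagonal on the ancilla qubits -/

section Block

variable {δ α : Type} [Fintype δ] [DecidableEq δ] [Fintype α] [DecidableEq α]

/-- The operator that acts as `F x` on the data qubits if the ancilla qubits are in state `x`. -/
def blk (F : (α → Fin 2) → Op δ) : Op (δ ⊕ α) :=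
  fun x y => if x ∘ Sum.inr = y ∘ Sum.inr then F (x ∘ Sum.inr) (x ∘ Sum.inl) (y ∘ Sum.inl) else 0

theorem blk_mul (F G : (α → Fin 2) → Op δ) : blk F * blk G = blk fun x => F x * G x := by
  ext x y
  rw [Matrix.mul_apply, ← (Equiv.sumArrowEquivProdArrow δ α (Fin 2)).symm.sum_comp,
    Fintype.sum_prod_type]
  simp only [blk, Equiv.sumArrowEquivProdArrow]
  have h1 : ∀ (u : δ → Fin 2) (v : α → Fin 2), (Sum.elim u v : δ ⊕ α → Fin 2) ∘ Sum.inr = v :=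
    fun _ _ => rfl
  have h2 : ∀ (u : δ → Fin 2) (v : α → Fin 2), (Sum.elim u v : δ ⊕ α → Fin 2) ∘ Sum.inl = u :=
    fun _ _ => rfl
  simp only [Equiv.coe_fn_symm_mk, h1, h2, ite_mul, zero_mul, mul_ite, mul_zero,
    Finset.sum_ite_eq', Finset.mem_univ, if_true, Matrix.mul_apply]
  split_ifs with h
  · simp [h]
  · simp

theorem blk_one : blk (fun _ : α → Fin 2 => (1 : Op δ)) = 1 := by
  ext x y
  have : x = y ↔ x ∘ Sum.inr = y ∘ Sum.inr ∧ x ∘ Sum.inl = y ∘ Sum.inl := by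
    constructor
    · rintro rfl; exact ⟨rfl, rfl⟩
    · rintro ⟨h1, h2⟩
      ext1 i
      rcases i with i | i
      exacts [congrFun h2 i, congrFun h1 i]
  simp only [blk, Matrix.one_apply, this, ite_and]

theorem blk_add (F G : (α → Fin 2) → Op δ) : blk F + blk G = blk fun x => F x + G x := by
  ext x y
  simp only [blk, Matrix.add_apply]
  split_ifs <;> simp

theorem smul_blk (c : ℂ) (F : (α → Fin 2) → Op δ) : c • blk F = blk fun x => c • F x := by
  ext x y
  simp only [blk, Matrix.smul_apply]
  split_ifs <;> simp

theorem blk_const (A : Op δ) : blk (fun _ : α → Fin 2 => A) = onQubits Function.Embedding.inl A := by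
  ext x y
  have : x ∘ Sum.inr = y ∘ Sum.inr ↔
      ∀ i, i ∉ Set.range (Function.Embedding.inl : δ ↪ δ ⊕ α) → x i = y i := by
    constructor
    · rintro h (i | i) hi
      · exact absurd ⟨i, rfl⟩ hi
      · exact congrFun h i
    · intro h
      ext1 i
      exact h _ (by simp)
  by_cases h : x ∘ Sum.inr = y ∘ Sum.inr
  · rw [blk, onQubits, if_pos h, if_pos (this.1 h)]; rfl
  · rw [blk, onQubits, if_neg h, if_neg fun h' => h (this.2 h')]

/-- The operator `F x` on the data qubits, controlled by the ancilla qubit `a`. -/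
def ctl (a : α) (F : (α → Fin 2) → Op δ) : Op (δ ⊕ α) := blk fun x => if x a = 1 then F x else 1

theorem ctl_one (a : α) : ctl a (fun _ => (1 : Op δ)) = 1 := by
  simp only [ctl, ite_self, blk_one]

theorem ctl_mul (a : α) (F G : (α → Fin 2) → Op δ) :
    ctl a F * ctl a G = ctl a fun x => F x * G x := by
  rw [ctl, ctl, ctl, blk_mul]
  congr 1
  ext1 x
  split_ifs <;> simp

theorem controlled_eq_ctl (a : α) (A : Op δ) :
    controlled (.inr a) (onQubits Function.Embedding.inl A) = ctl a fun _ => A := by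
  rw [← blk_const, ctl]
  have h1 : Matrix.diagonal (fun x : δ ⊕ α → Fin 2 => if x (.inr a) = 1 then (1 : ℂ) else 0) =
      blk fun x => if x a = 1 then 1 else 0 := by
    have : (1 : Op (δ ⊕ α)) = blk fun _ => 1 := blk_one.symm
    ext x y
    have h := congrFun (congrFun this x) y
    rw [Matrix.one_apply, blk] at h
    rw [Matrix.diagonal_apply, blk]
    by_cases hx : x (.inr a) = 1
    · rw [if_pos hx, h, if_pos (show (x ∘ Sum.inr) a = 1 from hx)]
    · rw [if_neg hx, if_neg (show ¬ (x ∘ Sum.inr) a = 1 from hx)]; simp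
  have h0 : Matrix.diagonal (fun x : δ ⊕ α → Fin 2 => if x (.inr a) = 0 then (1 : ℂ) else 0) =
      blk fun x => if x a = 0 then 1 else 0 := by
    have : (1 : Op (δ ⊕ α)) = blk fun _ => 1 := blk_one.symm
    ext x y
    have h := congrFun (congrFun this x) y
    rw [Matrix.one_apply, blk] at h
    rw [Matrix.diagonal_apply, blk]
    by_cases hx : x (.inr a) = 0
    · rw [if_pos hx, h, if_pos (show (x ∘ Sum.inr) a = 0 from hx)]
    · rw [if_neg hx, if_neg (show ¬ (x ∘ Sum.inr) a = 0 from hx)]; simp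
  rw [controlled, h0, h1, blk_mul, blk_add]
  congr 1
  ext1 x
  rcases Fin.exists_fin_two.1 ⟨x a, rfl⟩ with h | h <;> simp [h]

theorem onQubit_inl (q : δ) (σ : Pauli) :
    onQubit (.inl q : δ ⊕ α) σ = blk fun _ => onQubit q σ := by
  rw [blk_const, onQubit, onQubit, onQubits_pauliString]
  congr 1
  ext1 i
  rcases i with i | i
  · rw [show (Sum.inl i : δ ⊕ α) = Function.Embedding.inl i from rfl,
      Function.Embedding.inl.injective.extend_apply]
    by_cases h : i = q
    · subst h; simp
    · rw [Function.update_of_ne h, Function.update_of_ne]; simpa using h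
  · rw [Function.extend_apply' _ _ _ (by simp), Function.update_of_ne (by simp)]

theorem onQubit_Z (i : δ) :
    onQubit i .Z = Matrix.diagonal fun x => if x i = 1 then (-1 : ℂ) else 1 := by
  ext x y
  rw [Matrix.diagonal_apply, onQubit, pauliString]
  split_ifs with h h'
  · subst h
    rw [Fintype.prod_eq_single i]
    · simp [h', Pauli.mat]
    · intro j hj
      simp [hj]
  · subst h
    refine Finset.prod_eq_one fun j _ => ?_
    by_cases hj : j = i
    · subst hj
      have : x j = 0 := by omega
      simp [this, Pauli.mat]
    · simp [hj]
  · obtain ⟨j, hj⟩ := Function.ne_iff.1 h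
    refine Finset.prod_eq_zero (Finset.mem_univ j) ?_
    by_cases hji : j = i
    · subst hji
      rw [Function.update_self]
      generalize x j = u at *
      generalize y j = v at *
      fin_cases u <;> fin_cases v <;> simp_all [Pauli.mat]
    · rw [Function.update_of_ne hji, Pauli.mat_I, Matrix.one_apply_ne hj]

theorem onQubit_inr_Z (a : α) :
    onQubit (.inr a : δ ⊕ α) .Z = blk fun x => if x a = 1 then -1 else 1 := by
  rw [onQubit_Z]
  have : (1 : Op (δ ⊕ α)) = blk fun _ => 1 := blk_one.symm
  ext x y
  have h := congrFun (congrFun this x) y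
  rw [Matrix.one_apply, blk] at h
  rw [Matrix.diagonal_apply, blk]
  by_cases hx : x (.inr a) = 1
  · rw [if_pos hx, if_pos (show (x ∘ Sum.inr) a = 1 from hx)]
    have h' := congrArg Neg.neg h
    simpa only [neg_ite, apply_ite Neg.neg, neg_zero, Matrix.neg_apply] using h'
  · rw [if_neg hx, if_neg (show ¬ (x ∘ Sum.inr) a = 1 from hx), h]

/-- The state with the qubit `i` flipped. -/
def flipQubit {ι : Type} [DecidableEq ι] (i : ι) (x : ι → Fin 2) : ι → Fin 2 :=
  Function.update x i (x i + 1)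

theorem flipQubit_flipQubit {ι : Type} [DecidableEq ι] (i : ι) (x : ι → Fin 2) :
    flipQubit i (flipQubit i x) = x := by
  have : x i + 1 + 1 = x i := by generalize x i = u; fin_cases u <;> rfl
  simp [flipQubit, this]

theorem onQubit_X_apply (i : δ) (x y : δ → Fin 2) :
    onQubit i .X x y = if y = flipQubit i x then 1 else 0 := by
  rw [onQubit, pauliString]
  split_ifs with h
  · subst h
    refine Finset.prod_eq_one fun j _ => ?_
    by_cases hj : j = i
    · subst hj
      simp only [Function.update_self, flipQubit]
      generalize x j = u
      fin_cases u <;> simp [Pauli.mat]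
    · simp [flipQubit, hj]
  · obtain ⟨j, hj⟩ := Function.ne_iff.1 h
    refine Finset.prod_eq_zero (Finset.mem_univ j) ?_
    by_cases hji : j = i
    · subst hji
      simp only [flipQubit, Function.update_self] at hj ⊢
      generalize x j = u at *
      generalize y j = v at *
      fin_cases u <;> fin_cases v <;> simp_all [Pauli.mat]
    · rw [flipQubit, Function.update_of_ne hji] at hj
      rw [Function.update_of_ne hji, Pauli.mat_I, Matrix.one_apply_ne hj.symm]

theorem onQubit_X_mul_apply (i : δ) (B : Op δ) (x y : δ → Fin 2) :
    (onQubit i .X * B) x y = B (flipQubit i x) y := by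
  simp [Matrix.mul_apply, onQubit_X_apply]

theorem mul_onQubit_X_apply (i : δ) (B : Op δ) (x y : δ → Fin 2) :
    (B * onQubit i .X) x y = B x (flipQubit i y) := by
  have : ∀ z, y = flipQubit i z ↔ z = flipQubit i y := fun z =>
    ⟨fun h => by rw [h, flipQubit_flipQubit], fun h => by rw [h, flipQubit_flipQubit]⟩
  simp [Matrix.mul_apply, onQubit_X_apply, this]

/-- A bit flip permutes the blocks, so it commutes with every gate not controlled by `a`. -/
theorem blk_mul_onQubit_X (a : α) (F : (α → Fin 2) → Op δ) :
    blk F * onQubit (.inr a) .X = onQubit (.inr a) .X * blk fun x => F (flipQubit a x) := by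
  ext x y
  rw [mul_onQubit_X_apply, onQubit_X_mul_apply]
  have hr : ∀ z : δ ⊕ α → Fin 2, flipQubit (.inr a) z ∘ Sum.inr = flipQubit a (z ∘ Sum.inr) := by
    intro z
    ext1 b
    by_cases hb : b = a
    · subst hb; simp [flipQubit]
    · simp [flipQubit, hb]
  have hl : ∀ z : δ ⊕ α → Fin 2, flipQubit (.inr a) z ∘ Sum.inl = z ∘ Sum.inl := by
    intro z
    ext1 b
    simp [flipQubit]
  have hxy : x ∘ Sum.inr = flipQubit a (y ∘ Sum.inr) ↔ flipQubit a (x ∘ Sum.inr) = y ∘ Sum.inr :=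
    ⟨fun h => by rw [h, flipQubit_flipQubit], fun h => by rw [← h, flipQubit_flipQubit]⟩
  simp only [blk, hr, hl, hxy, flipQubit_flipQubit]

/-! ### Gate counts of controlled operators -/

/-- With `P = blk F`, the controlled operator is `(1 + Z + P - Z * P) / 2`. As `Z` and `P` are
commuting involutions, this is a product of quarter turns about `-Z`, `-P` and `Z * P`, up to an
eighth root of unity. -/
theorem ctl_eq_rot {F : (α → Fin 2) → Op δ} (hF : blk F * blk F = 1) (a : α) :
    ctl a F = ((Real.sqrt 2 : ℂ)⁻¹ * (1 + Complex.I)) • (rot (-(onQubit (.inr a) .Z)) *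
      rot (-(blk F)) * rot (onQubit (.inr a) .Z * blk F)) := by
  set Z : Op (δ ⊕ α) := onQubit (.inr a) .Z with hZ
  have hZZ : Z * Z = 1 := (isInvolutivePauli_onQubit _ _).2
  have hc : blk F * Z = Z * blk F := by
    rw [hZ, onQubit_inr_Z, blk_mul, blk_mul]
    congr 1
    ext1 x
    split_ifs <;> simp
  have h1 : ctl a F = (1 / 2 : ℂ) • (1 + Z + blk F - Z * blk F) := by
    rw [sub_eq_add_neg, ← neg_one_smul ℂ, hZ, onQubit_inr_Z, ← blk_one, blk_mul, smul_blk, blk_add,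
      blk_add, blk_add, smul_blk, ctl]
    congr 1
    ext1 x
    split_ifs
    · simp only [neg_mul, one_mul]; module
    · simp only [one_mul]; module
  set P := blk F
  have e1 : Z * (Z * P) = P := by rw [← mul_assoc, hZZ, one_mul]
  have e2 : P * (Z * P) = Z := by rw [← mul_assoc, hc, mul_assoc, hF, mul_one]
  have e3 : Z * P * (Z * P) = 1 := by rw [mul_assoc, e2, hZZ]
  rw [h1, rot, rot, rot, smul_mul_smul_comm, smul_mul_smul_comm, inv_sqrt_two_mul_self, smul_smul]
  have : (1 + Complex.I • -Z) * (1 + Complex.I • -P) * (1 + Complex.I • (Z * P)) =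
      (1 - Complex.I) • (1 + Z + P - Z * P) := by
    have hI : Complex.I ^ 3 = -Complex.I := by linear_combination Complex.I * Complex.I_sq
    simp only [mul_add, add_mul, mul_one, one_mul, smul_neg, neg_mul, mul_neg, e1, e2, e3,
      smul_mul_assoc, mul_smul_comm]
    match_scalars <;> ring_nf <;> simp only [Complex.I_sq, hI] <;> ring
  rw [this, smul_smul]
  congr 1
  have h2 := inv_sqrt_two_mul_self
  linear_combination (-(1 - Complex.I ^ 2) / 2) * h2 + 1/4 * Complex.I_sq

theorem star_inv_sqrt_two_mul : star ((Real.sqrt 2 : ℂ)⁻¹ * (1 + Complex.I)) *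
    ((Real.sqrt 2 : ℂ)⁻¹ * (1 + Complex.I)) = 1 := by
  have h2 := inv_sqrt_two_mul_self
  simp only [star_mul', star_inv₀, Complex.star_def, Complex.conj_ofReal, map_add, map_one,
    Complex.conj_I]
  linear_combination ((1 - Complex.I ^ 2)) * h2 - 1/2 * Complex.I_sq

theorem hasCost_ctl {w : ℕ} {F : (α → Fin 2) → Op δ} {T : Finset (δ ⊕ α)} (hT : T.card ≤ w)
    (h : PauliOn T (blk F)) (hF : blk F * blk F = 1) (a : α) :
    HasCost (6 * w + 10) (ctl a F) := by
  have : Nonempty (δ ⊕ α) := ⟨.inr a⟩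
  have hc : blk F * onQubit (.inr a) .Z = onQubit (.inr a) .Z * blk F := by
    rw [onQubit_inr_Z, blk_mul, blk_mul]
    congr 1
    ext1 x
    split_ifs <;> simp
  have hZ := pauliOn_onQubit (.inr a : δ ⊕ α) .Z
  have hZ' := isInvolutivePauli_onQubit (.inr a : δ ⊕ α) .Z
  have h' : IsInvolutivePauli (blk F) := ⟨h.isPauli, hF⟩
  have hU : (insert (.inr a) T).card ≤ w + 1 := (Finset.card_insert_le _ _).trans (by omega)
  have hZU := hZ.mono (show {.inr a} ⊆ insert (.inr a) T by simp)
  have hFU := h.mono (Finset.subset_insert (.inr a) T)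
  rw [ctl_eq_rot hF]
  have hneg : ∀ {A : Op (δ ⊕ α)}, PauliOn (insert (.inr a) T) A →
      PauliOn (insert (.inr a) T) (-A) := fun hA => by
    simpa using hA.smul (c := -1) (by norm_num)
  exact HasCost.mono ((((hasCost_rot (w + 1) hU (hneg hZU) hZ'.neg.2).mul
    (hasCost_rot (w + 1) hU (hneg hFU) h'.neg.2)).mul (hasCost_rot (w + 1) hU (hZU.mul hFU)
      (hZ'.mul_of_commute h' hc.symm).2)).smul star_inv_sqrt_two_mul) (by omega)

theorem blk_neg_one : blk (fun _ : α → Fin 2 => (-1 : Op δ)) = -1 := by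
  have := smul_blk (-1 : ℂ) (fun _ : α → Fin 2 => (1 : Op δ))
  simpa [blk_one] using this.symm

theorem hasCost_ctl_neg_one (a : α) : HasCost 10 (ctl a fun _ => (-1 : Op δ)) := by
  refine hasCost_ctl (w := 0) (T := ∅) (by simp) ?_ ?_ a
  · rw [blk_neg_one]
    refine ⟨-1, fun _ => .I, by norm_num, by simp, by rw [pauliString_I]; simp⟩
  · rw [blk_neg_one]; simp

/-- This is controlled-`Z` between two ancillas; it is the reason why `ctl` allows its operator to
depend on the ancilla state. -/
theorem hasCost_ctl_sign (a b : α) :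
    HasCost 16 (ctl a fun x => if x b = 1 then (-1 : Op δ) else 1) := by
  have h := onQubit_inr_Z (δ := δ) b
  refine hasCost_ctl (w := 1) (T := {.inr b}) (by simp) ?_ ?_ a
  · rw [← h]; exact pauliOn_onQubit _ _
  · rw [← h]; exact (isInvolutivePauli_onQubit _ _).2

theorem hasCost_ctl_smul_one (a : α) {c : ℂ} (hc : c ^ 4 = 1) :
    HasCost 20 (ctl a fun _ => c • (1 : Op δ)) := by
  have : Nonempty (δ ⊕ α) := ⟨.inr a⟩
  have hZ' := isInvolutivePauli_onQubit (.inr a : δ ⊕ α) .Z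
  -- The phase gate is a rotation about `-Z` up to a scalar; all fourth roots of unity come from it
  -- and `Z`.
  have hS : HasCost 4 (ctl a fun _ => Complex.I • (1 : Op δ)) := by
    have h := (hasCost_rot 1 (T := {.inr a}) (by simp) (A := -(onQubit (.inr a : δ ⊕ α) .Z))
      (by simpa using (pauliOn_onQubit (.inr a : δ ⊕ α) .Z).smul (c := -1) (by norm_num))
      hZ'.neg.2).smul star_inv_sqrt_two_mul
    convert h.mono (show 2 * 1 + 1 + 1 ≤ 4 by omega) using 1
    rw [rot, smul_smul, smul_neg, ← neg_smul, onQubit_inr_Z, ← blk_one, smul_blk, blk_add, smul_blk,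
      ctl]
    congr 1
    have h2 := inv_sqrt_two_mul_self
    have e1 : (Real.sqrt 2 : ℂ)⁻¹ * (1 + Complex.I) * (Real.sqrt 2 : ℂ)⁻¹ * (1 + Complex.I) =
        Complex.I := by
      linear_combination (1 + Complex.I) ^ 2 * h2 + 1/2 * Complex.I_sq
    have e2 : (Real.sqrt 2 : ℂ)⁻¹ * (1 + Complex.I) * (Real.sqrt 2 : ℂ)⁻¹ * (1 - Complex.I) =
        1 := by
      linear_combination (1 - Complex.I ^ 2) * h2 - 1/2 * Complex.I_sq
    ext1 x
    split_ifs
    · rw [show (1 : Op δ) + -Complex.I • -1 = (1 + Complex.I) • 1 by module, smul_smul, e1]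
    · rw [show (1 : Op δ) + -Complex.I • 1 = (1 - Complex.I) • 1 by module, smul_smul, e2, one_smul]
  have hZ := hasCost_ctl_neg_one (δ := δ) a
  have h4 : c = 1 ∨ c = -1 ∨ c = Complex.I ∨ c = -Complex.I := by
    have h : (c - 1) * ((c + 1) * ((c - Complex.I) * (c + Complex.I))) = 0 := by
      linear_combination hc - (c ^ 2 - 1) * Complex.I_sq
    simpa [sub_eq_zero, add_eq_zero_iff_eq_neg] using h
  rcases h4 with rfl | rfl | rfl | rfl
  · simpa [ctl_one] using hasCost_one.mono (Nat.zero_le 20)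
  · simpa using hZ.mono (by omega)
  · exact hS.mono (by omega)
  · have := hZ.mul hS
    rw [ctl_mul] at this
    simpa using this.mono (by omega)

theorem PauliOn.hasCost_ctl {w : ℕ} {T : Finset δ} (hT : T.card ≤ w) {A : Op δ} (h : PauliOn T A)
    (a : α) : HasCost (6 * w + 30) (ctl a fun _ => A) := by
  obtain ⟨c, p, hc, hp, rfl⟩ := h
  have h1 := hasCost_ctl_smul_one (δ := δ) a hc
  have h2 := ShorStyle.hasCost_ctl (w := w) (F := fun _ : α → Fin 2 => pauliString p)
    (T := T.map Function.Embedding.inl) (by rwa [Finset.card_map])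
    (by rw [blk_const]; exact PauliOn.onQubits ⟨1, p, by simp, hp, by simp⟩)
    (by rw [blk_mul]; simp only [pauliString_mul_self, blk_one]) a
  have := h1.mul h2
  rw [ctl_mul] at this
  simp only [smul_mul_assoc, one_mul] at this
  exact this.mono (by omega)

end Block

/-! ### Propagation of errors through circuits of controlled gates -/

section Propagation

variable {δ α κ : Type} [Fintype δ] [DecidableEq δ] [Fintype α] [DecidableEq α] [Fintype κ]
  [DecidableEq κ]

/-- The circuit in which the ancillas in the list `l` control the operators `act b`. -/
def circuit (act : α → Op δ) (l : List α) : Op (δ ⊕ α) :=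
  idealCircuit (l.map fun b => ctl b fun _ => act b)

/-- The error `E` before the circuit is equivalent to an error of at most `N` gates after it. -/
def Propagates (act : α → Op δ) (l : List α) (E : Op (δ ⊕ α)) (N : ℕ) : Prop :=
  ∃ E', HasCost N E' ∧ circuit act l * E = E' * circuit act l

variable {act : α → Op δ}

theorem circuit_nil : circuit act [] = 1 := rfl

theorem circuit_cons (b : α) (l : List α) :
    circuit act (b :: l) = circuit act l * ctl b fun _ => act b := rfl

theorem circuit_append (l l' : List α) :
    circuit act (l ++ l') = circuit act l' * circuit act l := by
  induction l with
  | nil => rw [List.nil_append, circuit_nil, mul_one]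
  | cons b l ih => rw [List.cons_append, circuit_cons, ih, circuit_cons, mul_assoc]

theorem Propagates.mono {l : List α} {E : Op (δ ⊕ α)} {M N : ℕ} (h : Propagates act l E M)
    (hMN : M ≤ N) : Propagates act l E N := by
  obtain ⟨E', h1, h2⟩ := h
  exact ⟨E', h1.mono hMN, h2⟩

theorem Propagates.mul {l : List α} {E F : Op (δ ⊕ α)} {M N : ℕ} (hE : Propagates act l E M)
    (hF : Propagates act l F N) : Propagates act l (E * F) (M + N) := by
  obtain ⟨E', h1, h2⟩ := hE
  obtain ⟨F', h3, h4⟩ := hF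
  exact ⟨E' * F', h1.mul h3, by rw [← mul_assoc, h2, mul_assoc, h4, mul_assoc]⟩

theorem propagates_one {l : List α} : Propagates act l 1 0 :=
  ⟨1, hasCost_one, by rw [mul_one, one_mul]⟩

theorem propagates_list_prod {l : List α} {N : ℕ} {L : List (Op (δ ⊕ α))}
    (h : ∀ E ∈ L, Propagates act l E N) : Propagates act l L.prod (L.length * N) := by
  induction L with
  | nil => exact propagates_one.mono (Nat.zero_le _)
  | cons E L ih =>
    rw [List.prod_cons, List.length_cons]
    exact ((h E (by simp)).mul (ih fun F hF => h F (by simp [hF]))).mono (by rw [add_mul]; omega)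

theorem HasCost.propagates_of_commute {l : List α} {E : Op (δ ⊕ α)} {N : ℕ} (hE : HasCost N E)
    (h : ∀ b ∈ l, Commute (ctl b fun _ => act b) E) : Propagates act l E N := by
  refine ⟨E, hE, ?_⟩
  induction l with
  | nil => rw [circuit_nil, one_mul, mul_one]
  | cons b l ih =>
    rw [circuit_cons, mul_assoc, (h b (by simp)).eq, ← mul_assoc, ih fun c hc => h c (by simp [hc]),
      mul_assoc]

theorem commute_blk_smul_one (F : (α → Fin 2) → Op δ) (d : (α → Fin 2) → ℂ) :
    Commute (blk F) (blk fun x => d x • (1 : Op δ)) := by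
  rw [commute_iff_eq, blk_mul, blk_mul]
  congr 1
  ext1 x
  simp

theorem commute_blk_ctl_smul_one (F : (α → Fin 2) → Op δ) (a : α) (d : (α → Fin 2) → ℂ) :
    Commute (blk F) (ctl a fun x => d x • (1 : Op δ)) := by
  have := commute_blk_smul_one F fun x => if x a = 1 then d x else 1
  simp only [ite_smul, one_smul] at this
  exact this

/-- An error that picks up the error `B b` when it crosses the gate of the ancilla `b`. -/
theorem propagates_of_forall {E : Op (δ ⊕ α)} {N₀ : ℕ} (hE : HasCost N₀ E) {B : α → Op (δ ⊕ α)}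
    {N : α → ℕ} (hEB : ∀ b, (ctl b fun _ => act b) * E = E * B b * ctl b fun _ => act b)
    (hB : ∀ b (l : List α), l.Nodup → Propagates act l (B b) (N b)) {l : List α} (hl : l.Nodup) :
    Propagates act l E (N₀ + ∑ b, N b) := by
  have : Propagates act l E (N₀ + (l.map N).sum) := by
    induction l with
    | nil => exact ⟨E, hE, by rw [circuit_nil, one_mul, mul_one]⟩
    | cons b l ih =>
      have hl' := (List.nodup_cons.1 hl).2
      obtain ⟨E', h1, h2⟩ := (ih hl').mul (hB b l hl')
      refine ⟨E', h1.mono (by rw [List.map_cons, List.sum_cons]; omega), ?_⟩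
      rw [circuit_cons, mul_assoc, hEB, ← mul_assoc, h2, mul_assoc]
  -- No ancilla occurs twice in `l`, so the sum along the list is at most the sum over all ancillas.
  refine this.mono (Nat.add_le_add_left ?_ _)
  rw [← List.sum_toFinset N hl]
  exact Finset.sum_le_sum_of_subset (Finset.subset_univ _)

/-- Propagation of a controlled Pauli operator that commutes or anticommutes with all gates. -/
theorem propagates_ctl {a : α} {Q : Op δ} {N₀ : ℕ} (hQ : HasCost N₀ (ctl a fun _ => Q))
    {T : Finset α} (h : ∀ b, act b * Q = Q * act b ∨ b ∈ T ∧ act b * Q = -(Q * act b))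
    {l : List α} (hl : l.Nodup) : Propagates act l (ctl a fun _ => Q) (N₀ + T.card * 16) := by
  classical
  -- An anticommuting crossing gives `-1` exactly on the blocks where both `a` and `b` are 1. The
  -- resulting controlled sign is scalar on each block and passes all later gates unchanged.
  have := propagates_of_forall (act := act) hQ
    (B := fun b => if act b * Q = Q * act b then 1 else ctl a fun x => if x b = 1 then -1 else 1)
    (N := fun b => if b ∈ T then 16 else 0) ?_ ?_ hl
  · refine this.mono (le_of_eq ?_)
    simp
  · intro b
    by_cases hc : act b * Q = Q * act b
    · simp only [if_pos hc, mul_one]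
      rw [ctl, ctl, blk_mul, blk_mul]
      congr 1
      ext1 x
      split_ifs <;> simp [hc]
    · have hc' := ((h b).resolve_left hc).2
      simp only [if_neg hc]
      rw [ctl, ctl, ctl, blk_mul, blk_mul, blk_mul]
      congr 1
      ext1 x
      split_ifs <;> simp [hc']
  · intro b l' _
    by_cases hc : act b * Q = Q * act b
    · simp only [if_pos hc]
      exact propagates_one.mono (Nat.zero_le _)
    · simp only [if_neg hc, if_pos ((h b).resolve_left hc).1]
      refine (hasCost_ctl_sign a b).propagates_of_commute fun c _ => ?_
      have := commute_blk_ctl_smul_one (fun x => if x c = 1 then act c else 1) a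
        fun x => if x b = 1 then -1 else 1
      simp only [ite_smul, neg_smul, one_smul] at this
      exact this

/-- Propagation of a Pauli operator on the data qubits. -/
theorem propagates_blk_pauli {P : Op δ} {N₀ N : ℕ}
    (hP : HasCost N₀ (blk fun _ : α → Fin 2 => P)) {T₁ T₂ : Finset α}
    (h : ∀ b, act b * P = P * act b ∨ (b ∈ T₁ ∧ act b * P = -(P * act b)) ∨
      (b ∈ T₂ ∧ ∃ Q, act b * P = P * Q * act b ∧
        ∀ l : List α, l.Nodup → Propagates act l (ctl b fun _ => Q) N))
    {l : List α} (hl : l.Nodup) :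
    Propagates act l (blk fun _ => P) (N₀ + (T₁.card * 10 + T₂.card * N)) := by
  classical
  have hB : ∀ b, ∃ B, ((ctl b fun _ => act b) * (blk fun _ => P) =
      (blk fun _ => P) * B * ctl b fun _ => act b) ∧ ∀ l : List α, l.Nodup →
        Propagates act l B ((if b ∈ T₁ then 10 else 0) + if b ∈ T₂ then N else 0) := by
    intro b
    rcases h b with hc | ⟨hb, hc⟩ | ⟨hb, Q, hc, hQ⟩
    · refine ⟨1, ?_, fun l _ => propagates_one.mono (Nat.zero_le _)⟩
      rw [mul_one, ctl, blk_mul, blk_mul]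
      congr 1
      ext1 x
      split_ifs <;> simp [hc]
    · refine ⟨ctl b fun _ => -1, ?_, fun l _ => ?_⟩
      · rw [ctl, ctl, blk_mul, blk_mul, blk_mul]
        congr 1
        ext1 x
        split_ifs <;> simp [hc]
      · rw [if_pos hb]
        refine ((hasCost_ctl_neg_one b).propagates_of_commute fun c _ => ?_).mono (by omega)
        have := commute_blk_ctl_smul_one (fun x => if x c = 1 then act c else 1) b fun _ => -1
        simp only [neg_smul, one_smul] at this
        exact this
    · refine ⟨ctl b fun _ => Q, ?_, fun l hl => ?_⟩
      · rw [ctl, ctl, blk_mul, blk_mul, blk_mul]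
        congr 1
        ext1 x
        split_ifs <;> simp [hc]
      · rw [if_pos hb]
        exact (hQ l hl).mono (by omega)
  choose B hB1 hB2 using hB
  refine (propagates_of_forall hP hB1 hB2 hl).mono (le_of_eq ?_)
  rw [Finset.sum_add_distrib]
  simp

/-- How the sign in the commutation relation of `v` and `p v p†` changes if `p` is multiplied by
an involutive Pauli operator. -/
theorem exists_sign {v A : Op κ} (hv : IsClifford v) {c : ℂ} (hc : v * v = c • 1)
    (hA : IsInvolutivePauli A) : ∃ s : ℂ, (s = 1 ∨ s = -1) ∧ ∀ (p : Op κ) (χ : ℂ), IsPauli p →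
      v * (p * v * pᴴ) = χ • (p * v * pᴴ * v) →
      v * (A * p * v * (A * p)ᴴ) = (s * χ) • (A * p * v * (A * p)ᴴ * v) := by
  have hA' := hv.conj_isInvolutivePauli hA
  have hvA : v * A = v * A * vᴴ * v := (hv.conj_mul A).symm
  -- Since `v * v` is scalar, conjugation by `v` is an involution: it swaps `A` and `A'`.
  have hvA' : v * (v * A * vᴴ) = A * v := by
    rw [← mul_assoc, ← mul_assoc, hc, smul_mul_assoc, one_mul, smul_mul_assoc, ← mul_smul_comm]
    congr 1
    calc c • vᴴ = (v * v) * vᴴ := by rw [hc, smul_mul_assoc, one_mul]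
      _ = v := by rw [mul_assoc, hv.mul_star, mul_one]
  set A' := v * A * vᴴ
  clear_value A'
  -- The sign is the one between `A` and its conjugate by `v`; it is fixed before `p` enters.
  obtain ⟨s, hs, hAA⟩ : ∃ s : ℂ, (s = 1 ∨ s = -1) ∧ A' * A = s • (A * A') := by
    rcases hA'.1.mul_comm hA.1 with h | h
    · exact ⟨1, Or.inl rfl, by rw [h, one_smul]⟩
    · exact ⟨-1, Or.inr rfl, by rw [h, neg_one_smul]⟩
  have hss : s * s = 1 := by rcases hs with rfl | rfl <;> norm_num
  refine ⟨s, hs, fun p χ hp hχ => ?_⟩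
  -- The sign `e` of `A * A'` against `p` occurs once for `p` and once for `pᴴ`, so it cancels and
  -- `p` has no influence on `s`.
  obtain ⟨e, he, hRp⟩ : ∃ e : ℂ, e * e = 1 ∧ A * A' * p = e • (p * (A * A')) := by
    rcases (hA.1.mul hA'.1).mul_comm hp with h | h
    · exact ⟨1, by norm_num, by rw [h, one_smul]⟩
    · exact ⟨-1, by norm_num, by rw [h, neg_one_smul]⟩
  have hpR : A * A' * pᴴ = e • (pᴴ * (A * A')) := by
    have : pᴴ * (A * A' * p) * pᴴ = e • (pᴴ * p * (A * A') * pᴴ) := by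
      rw [hRp, mul_smul_comm, smul_mul_assoc, ← mul_assoc pᴴ p]
    rw [hp.conjTranspose_mul_self, one_mul, mul_assoc, mul_assoc (A * A'),
      hp.mul_conjTranspose_self, mul_one] at this
    rw [this, smul_smul, he, one_smul]
  have hRv : A * A' * v = s • (v * (A * A')) := by
    calc A * A' * v = A * v * A := by rw [mul_assoc, ← hvA, mul_assoc]
      _ = v * (A' * A) := by rw [← hvA', mul_assoc]
      _ = s • (v * (A * A')) := by rw [hAA, mul_smul_comm]
  set T := p * v * pᴴ with hT
  clear_value T
  have hRT : A * A' * T = s • (T * (A * A')) := by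
    calc A * A' * T = (A * A' * p) * v * pᴴ := by rw [hT]; simp only [mul_assoc]
      _ = e • (p * (A * A' * v) * pᴴ) := by rw [hRp]; simp only [smul_mul_assoc, mul_assoc]
      _ = (e * s) • (p * v * (A * A' * pᴴ)) := by
        rw [hRv, mul_smul_comm, smul_mul_assoc, smul_smul]; simp only [mul_assoc]
      _ = s • (T * (A * A')) := by
        rw [hpR, mul_smul_comm, smul_smul, mul_right_comm, he, one_mul, hT]
        simp only [mul_assoc]
  have hATA : A' * T * A' = s • (A * T * A) := by
    calc A' * T * A' = A * (A * A' * T) * A' := by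
          rw [← mul_assoc, ← mul_assoc A A A', hA.2, one_mul]
      _ = s • (A * T * A * (A' * A')) := by
          rw [hRT, mul_smul_comm, smul_mul_assoc]; simp only [mul_assoc]
      _ = s • (A * T * A) := by rw [hA'.2, mul_one]
  have e1 : A * p * v * (A * p)ᴴ = A * T * A := by
    rw [Matrix.conjTranspose_mul, hA.conjTranspose, hT]
    simp only [mul_assoc]
  rw [e1]
  calc v * (A * T * A) = v * A * T * A := by simp only [mul_assoc]
    _ = A' * (v * T) * A := by rw [hvA]; simp only [mul_assoc]
    _ = χ • (A' * T * (v * A)) := by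
      rw [hχ, mul_smul_comm, smul_mul_assoc]; simp only [mul_assoc]
    _ = χ • (A' * T * A' * v) := by rw [hvA]; simp only [mul_assoc]
    _ = (s * χ) • (A * T * A * v) := by
      rw [hATA, smul_mul_assoc, smul_smul, _root_.mul_comm χ s]

/-- Propagation of a tensor factor of the transversal operator. -/
theorem propagates_blk_factor {f : κ ↪ δ} {v : Op κ} (hv : IsClifford v) {c : ℂ}
    (hc : v * v = c • 1) {T₁ T₂ : Finset α} {N₀ N : ℕ}
    (hv₀ : HasCost N₀ (blk fun _ : α → Fin 2 => onQubits f v))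
    (h : ∀ b, (∀ B : Op κ, Commute (act b) (onQubits f B)) ∨
      (b ∈ T₁ ∧ HasCost N (ctl b fun _ => act b) ∧
        ∃ A : Op κ, IsInvolutivePauli A ∧ act b = onQubits f A) ∨
      (b ∈ T₂ ∧ act b = onQubits f v))
    {l : List α} (hl : l.Nodup) :
    Propagates act l (blk fun _ => onQubits f v)
      (2 * (T₁.card * N) + N₀ + T₂.card * (T₁.card * 16)) := by
  classical
  have hcount : ∀ (T : Finset α) {l : List α}, l.Nodup → l.countP (· ∈ T) ≤ T.card := by
    intro T l hl
    rw [List.countP_eq_length_filter, ← List.toFinset_card_of_nodup (hl.filter _)]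
    exact Finset.card_le_card fun b hb => by simpa using (List.mem_filter.1 (List.mem_toFinset.1 hb)).2
  -- The form of the error after a prefix of the circuit: `p` collects the Paulis of the checks
  -- crossed, `χ` is its commutation sign with `v`, and `d` collects the signs already paid at
  -- copies of `v`. The induction appends gates at the end because the error changes form as it
  -- advances.
  have key : ∃ (p : (α → Fin 2) → Op κ) (χ d : (α → Fin 2) → ℂ), (∀ x, IsPauli (p x)) ∧
      HasCost (l.countP (· ∈ T₁) * N) (blk fun x => onQubits f (p x)) ∧
      HasCost (l.countP (· ∈ T₁) * N) (blk fun x => onQubits f (p x)ᴴ) ∧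
      (∀ x, v * (p x * v * (p x)ᴴ) = χ x • (p x * v * (p x)ᴴ * v)) ∧
      (∀ b, HasCost (l.countP (· ∈ T₁) * 16) (ctl b fun x => χ x • (1 : Op δ))) ∧
      HasCost (l.countP (· ∈ T₂) * (T₁.card * 16)) (blk fun x => d x • (1 : Op δ)) ∧
      circuit act l * (blk fun _ => onQubits f v) =
        (blk fun x => onQubits f (p x * v * (p x)ᴴ)) * (blk fun x => d x • 1) * circuit act l := by
    induction l using List.reverseRecOn with
    | nil =>
      refine ⟨fun _ => 1, fun _ => 1, fun _ => 1, fun _ => isPauli_one, ?_, ?_, ?_, fun b => ?_, ?_,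
        ?_⟩
      · simp only [onQubits_one, blk_one]; exact hasCost_one.mono (Nat.zero_le _)
      · simp only [Matrix.conjTranspose_one, onQubits_one, blk_one]
        exact hasCost_one.mono (Nat.zero_le _)
      · intro x; simp
      · simp only [one_smul, ctl_one]; exact hasCost_one.mono (Nat.zero_le _)
      · simp only [one_smul, blk_one]; exact hasCost_one.mono (Nat.zero_le _)
      · simp [circuit_nil, blk_one]
    | append_singleton l b ih =>
      have hl' : l.Nodup := (List.nodup_append.1 hl).1
      obtain ⟨p, χ, d, hp, hp1, hp2, hχ, hχ', hd, hE⟩ := ih hl'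
      have hm : ∀ T : Finset α, l.countP (· ∈ T) ≤ (l ++ [b]).countP (· ∈ T) := fun T => by
        rw [List.countP_append]; omega
      have hb' : ∀ {T : Finset α}, b ∈ T →
          (l ++ [b]).countP (· ∈ T) = l.countP (· ∈ T) + 1 := fun {T} hbT => by
        rw [List.countP_append]; simp [hbT]
      have hcirc : circuit act (l ++ [b]) = (ctl b fun _ => act b) * circuit act l := by
        rw [circuit_append, circuit_cons, circuit_nil, one_mul]
      have hstep : ∀ {F D : Op (δ ⊕ α)}, (ctl b fun _ => act b) *
          ((blk fun x => onQubits f (p x * v * (p x)ᴴ)) * blk fun x => d x • 1) =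
            F * D * (ctl b fun _ => act b) →
          circuit act (l ++ [b]) * (blk fun _ => onQubits f v) = F * D * circuit act (l ++ [b]) := by
        intro F D hFD
        rw [hcirc, mul_assoc, hE, ← mul_assoc, hFD, mul_assoc]
      rcases h b with hb | ⟨hb, hbN, A, hA, hbA⟩ | ⟨hb, hbv⟩
      · refine ⟨p, χ, d, hp, hp1.mono (Nat.mul_le_mul_right _ (hm _)),
          hp2.mono (Nat.mul_le_mul_right _ (hm _)), hχ,
          fun a => (hχ' a).mono (Nat.mul_le_mul_right _ (hm _)),
          hd.mono (Nat.mul_le_mul_right _ (hm _)), ?_⟩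
        refine hstep ?_
        rw [ctl, blk_mul, blk_mul, blk_mul]
        congr 1
        ext1 x
        split_ifs
        · rw [mul_smul_comm, mul_one, mul_smul_comm, smul_mul_assoc, (hb _).eq]
        · simp
      -- A controlled Pauli on the support multiplies `p` by `A` when bit `b` is set, and hence `χ`
      -- by the fixed sign `s`: one more controlled-`Z`.
      · obtain ⟨s, hs, hsign⟩ := exists_sign hv hc hA
        refine ⟨fun x => if x b = 1 then A * p x else p x, fun x => if x b = 1 then s * χ x else χ x,
          d, fun x => ?_, ?_, ?_, fun x => ?_, fun a => ?_, hd.mono (Nat.mul_le_mul_right _ (hm _)),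
          ?_⟩
        · dsimp only
          split_ifs
          exacts [hA.1.mul (hp x), hp x]
        · rw [hb' hb]
          convert (hbN.mul hp1).mono (show _ ≤ (l.countP (· ∈ T₁) + 1) * N by rw [add_mul]; omega)
            using 1
          rw [ctl, blk_mul]
          congr 1
          ext1 x
          dsimp only
          split_ifs
          · rw [hbA, onQubits_mul]
          · rw [one_mul]
        · rw [hb' hb]
          convert (hp2.mul hbN).mono (show _ ≤ (l.countP (· ∈ T₁) + 1) * N by rw [add_mul]; omega)
            using 1
          rw [ctl, blk_mul]
          congr 1
          ext1 x
          dsimp only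
          split_ifs
          · rw [hbA, Matrix.conjTranspose_mul, hA.conjTranspose, onQubits_mul]
          · rw [mul_one]
        · dsimp only
          split_ifs
          exacts [hsign _ _ (hp x) (hχ x), hχ x]
        · rw [hb' hb]
          have hs' : HasCost 16 (ctl a fun x => (if x b = 1 then s else 1) • (1 : Op δ)) := by
            rcases hs with rfl | rfl
            · simp only [ite_self, one_smul, ctl_one]; exact hasCost_one.mono (Nat.zero_le _)
            · simpa only [ite_smul, neg_smul, one_smul] using hasCost_ctl_sign a b
          convert ((hχ' a).mul hs').mono
            (show _ ≤ (l.countP (· ∈ T₁) + 1) * 16 by omega) using 1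
          rw [ctl_mul]
          congr 1
          ext1 x
          dsimp only
          split_ifs
          · rw [smul_mul_smul_comm, mul_one, _root_.mul_comm s]
          · rw [smul_mul_smul_comm, mul_one, mul_one]
        · refine hstep ?_
          rw [ctl, blk_mul, blk_mul, blk_mul, blk_mul]
          congr 1
          ext1 x
          dsimp only
          split_ifs
          · simp only [mul_smul_comm, mul_one, smul_mul_assoc]
            rw [hbA, Matrix.conjTranspose_mul, hA.conjTranspose, ← onQubits_mul, ← onQubits_mul]
            congr 2
            calc A * (p x * v * (p x)ᴴ) = A * (p x * v * (p x)ᴴ) * (A * A) := by rw [hA.2, mul_one]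
              _ = _ := by simp only [mul_assoc]
          · simp
      -- Another copy of `v` leaves `p` alone and deposits the sign `χ x` controlled by `b`.
      · refine ⟨p, χ, fun x => if x b = 1 then χ x * d x else d x, hp,
          hp1.mono (Nat.mul_le_mul_right _ (hm _)), hp2.mono (Nat.mul_le_mul_right _ (hm _)), hχ,
          fun a => (hχ' a).mono (Nat.mul_le_mul_right _ (hm _)), ?_, ?_⟩
        · rw [hb' hb]
          have h1 := (hχ' b).mono (Nat.mul_le_mul_right 16 (hcount T₁ hl'))
          convert (h1.mul hd).mono
            (show _ ≤ (l.countP (· ∈ T₂) + 1) * (T₁.card * 16) by rw [add_mul]; omega) using 1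
          rw [ctl, blk_mul]
          congr 1
          ext1 x
          dsimp only
          split_ifs
          · rw [smul_mul_smul_comm, mul_one]
          · rw [one_mul]
        · refine hstep ?_
          rw [ctl, blk_mul, blk_mul, blk_mul, blk_mul]
          congr 1
          ext1 x
          dsimp only
          split_ifs
          · simp only [mul_smul_comm, mul_one, smul_mul_assoc]
            rw [hbv, ← onQubits_mul, ← onQubits_mul, hχ, onQubits_smul, smul_smul, _root_.mul_comm (d x)]
          · simp
  obtain ⟨p, χ, d, -, hp1, hp2, -, -, hd, hE⟩ := key
  refine ⟨_, ?_, hE⟩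
  have h1 := Nat.mul_le_mul_right N (hcount T₁ hl)
  have h2 := Nat.mul_le_mul_right (T₁.card * 16) (hcount T₂ hl)
  have := ((hp1.mul hv₀).mul hp2).mul hd
  rw [blk_mul, blk_mul] at this
  simp only [← onQubits_mul] at this
  exact this.mono (by omega)

theorem commute_onQubit_X {a b : α} (h : a ≠ b) (A : Op δ) :
    Commute (ctl b fun _ => A) (onQubit (.inr a) .X) := by
  rw [commute_iff_eq, ctl, blk_mul_onQubit_X]
  simp only [flipQubit, Function.update_of_ne h.symm]

/-- Propagation of a bit flip of an ancilla. -/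
theorem propagates_onQubit_X {a : α} {c : ℂ} (hc : act a * act a = c • 1) (hc4 : c ^ 4 = 1) {N : ℕ}
    (h : ∀ l : List α, l.Nodup → Propagates act l (blk fun _ => act a) N)
    {l : List α} (hl : l.Nodup) :
    Propagates act l (onQubit (.inr a) .X) (27 + N) := by
  have : Nonempty (δ ⊕ α) := ⟨.inr a⟩
  have hX := (pauliOn_onQubit (.inr a : δ ⊕ α) .X).hasCost (w := 1) (by simp)
  have hcomm : ∀ {l : List α}, a ∉ l → Propagates act l (onQubit (.inr a) .X) 7 := fun {l} hal =>
    HasCost.propagates_of_commute hX fun b hb =>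
      commute_onQubit_X (fun hab : a = b => hal (hab ▸ hb)) _
  by_cases ha : a ∈ l
  · obtain ⟨l₁, l₂, rfl⟩ := List.append_of_mem ha
    rw [List.nodup_append] at hl
    obtain ⟨hl1, hl2, hl3⟩ := hl
    have ha2 := (List.nodup_cons.1 hl2).1
    have ha1 : a ∉ l₁ := fun h1 => hl3 a h1 a (by simp) rfl
    have hcc : c⁻¹ ^ 4 = 1 := by rw [inv_pow, hc4, inv_one]
    have hc0 : c ≠ 0 := by rintro rfl; norm_num at hc4
    have h2 : Propagates act l₂ (ctl a fun _ => c⁻¹ • (1 : Op δ)) 20 :=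
      (hasCost_ctl_smul_one a hcc).propagates_of_commute fun b _ =>
        commute_blk_ctl_smul_one _ _ fun _ => c⁻¹
    obtain ⟨E, hE, hE'⟩ := ((hcomm ha2).mul h2).mul (h l₂ (List.nodup_cons.1 hl2).2)
    refine ⟨E, hE, ?_⟩
    have hx : circuit act l₁ * onQubit (.inr a) .X = onQubit (.inr a) .X * circuit act l₁ := by
      clear hl1 hl3 ha
      induction l₁ with
      | nil => rw [circuit_nil, one_mul, mul_one]
      | cons b l ih =>
        rw [List.mem_cons, not_or] at ha1
        rw [circuit_cons, mul_assoc, (commute_onQubit_X ha1.1 (act b)).eq, ← mul_assoc, ih ha1.2,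
          mul_assoc]
    -- After the flip the operator acts on the blocks where bit `a` is 0. Applying it to all blocks
    -- and then undoing it where the bit is 1 uses the inverse `c⁻¹ • act a`; this produces the
    -- controlled phase, of cost 20, beside the 7 gates for `X`.
    have hg : (ctl a fun _ => act a) * onQubit (.inr a) .X = onQubit (.inr a) .X *
        (ctl a fun _ => c⁻¹ • (1 : Op δ)) * (blk fun _ => act a) * ctl a fun _ => act a := by
      rw [ctl, blk_mul_onQubit_X, mul_assoc, mul_assoc, ctl, blk_mul, blk_mul]
      congr 2
      ext1 x
      simp only [flipQubit, Function.update_self]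
      rcases Fin.exists_fin_two.1 ⟨x a, rfl⟩ with h | h
      · simp [h]
      · simp [h, hc, smul_smul, mul_inv_cancel₀ hc0]
    rw [circuit_append, circuit_cons, mul_assoc, hx, ← mul_assoc, mul_assoc (circuit act l₂), hg,
      ← mul_assoc (circuit act l₂), hE']
    simp only [mul_assoc]
  · exact (hcomm ha).mono (by omega)

end Propagation

/-! ### The gates of a protocol -/

section Site

variable {ι κ : Type} [Fintype ι] [DecidableEq ι] [Fintype κ] [DecidableEq κ]

theorem onQubits_onQubit (f : κ ↪ ι) (j : κ) (σ : Pauli) :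
    onQubits f (onQubit j σ) = onQubit (f j) σ := by
  rw [onQubit, onQubit, onQubits_pauliString]
  congr 1
  ext1 i
  by_cases hi : i ∈ Set.range f
  · obtain ⟨j', rfl⟩ := hi
    rw [f.injective.extend_apply]
    by_cases h : j' = j
    · rw [h, Function.update_self, Function.update_self]
    · rw [Function.update_of_ne h, Function.update_of_ne (f.injective.ne h)]
  · rw [Function.extend_apply' _ _ _ hi, Function.update_of_ne]
    rintro rfl
    exact hi ⟨j, rfl⟩

theorem commute_onQubit_onQubits {f : κ ↪ ι} {i : ι} (hi : i ∉ Set.range f) (σ : Pauli) (B : Op κ) :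
    Commute (onQubit i σ) (onQubits f B) := by
  let g : Fin 1 ↪ ι := ⟨fun _ => i, fun _ _ _ => Subsingleton.elim _ _⟩
  have := onQubits_commute (f := g) (g := f) (by
    rw [Set.disjoint_left]
    rintro _ ⟨_, rfl⟩
    exact hi) (onQubit 0 σ) B
  rwa [onQubits_onQubit] at this

end Site

namespace TransversalPSC

variable {n ℓ : ℕ} (U : TransversalPSC n ℓ)

/-- The other factors have disjoint supports and commute past, so the whole product conjugates an
operator on the site of `i` by `U.V i` alone. -/
theorem prod_mul_onQubits {L : List (Fin ℓ)} (hL : L.Nodup) {i : Fin ℓ} (hi : i ∈ L)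
    (B : Op (Fin (U.arity i))) :
    (L.map fun j => onQubits (U.site j) (U.V j)).prod * onQubits (U.site i) B =
      onQubits (U.site i) (U.V i * B * (U.V i)ᴴ) *
        (L.map fun j => onQubits (U.site j) (U.V j)).prod := by
  obtain ⟨l₁, l₂, rfl⟩ := List.append_of_mem hi
  have hcomm : ∀ l : List (Fin ℓ), i ∉ l → ∀ B : Op (Fin (U.arity i)),
      Commute (l.map fun j => onQubits (U.site j) (U.V j)).prod (onQubits (U.site i) B) := by
    intro l hl B
    refine Commute.list_prod_left _ _ fun A hA => ?_
    obtain ⟨j, hj, rfl⟩ := List.mem_map.1 hA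
    exact onQubits_commute (U.disjoint j i fun h => hl (h ▸ hj)) _ _
  rw [List.nodup_append] at hL
  obtain ⟨h1, h2, h3⟩ := hL
  have hi2 := (List.nodup_cons.1 h2).1
  have hi1 : i ∉ l₁ := fun h => h3 i h i (by simp) rfl
  have hV : onQubits (U.site i) (U.V i) * onQubits (U.site i) B =
      onQubits (U.site i) (U.V i * B * (U.V i)ᴴ) * onQubits (U.site i) (U.V i) := by
    rw [← onQubits_mul, ← onQubits_mul, (U.isPSC i).1.conj_mul]
  rw [List.map_append, List.prod_append, List.map_cons, List.prod_cons]
  set A₁ := (l₁.map fun j => onQubits (U.site j) (U.V j)).prod with hA1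
  set A₂ := (l₂.map fun j => onQubits (U.site j) (U.V j)).prod with hA2
  have c2 : A₂ * onQubits (U.site i) B = onQubits (U.site i) B * A₂ := (hcomm l₂ hi2 B).eq
  have c1 : A₁ * onQubits (U.site i) (U.V i * B * (U.V i)ᴴ) =
    onQubits (U.site i) (U.V i * B * (U.V i)ᴴ) * A₁ := (hcomm l₁ hi1 _).eq
  clear_value A₁ A₂
  calc A₁ * (onQubits (U.site i) (U.V i) * A₂) * onQubits (U.site i) B
      = A₁ * (onQubits (U.site i) (U.V i) * (A₂ * onQubits (U.site i) B)) := by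
        simp only [mul_assoc]
    _ = A₁ * (onQubits (U.site i) (U.V i) * onQubits (U.site i) B) * A₂ := by
        rw [c2]; simp only [mul_assoc]
    _ = A₁ * onQubits (U.site i) (U.V i * B * (U.V i)ᴴ) * onQubits (U.site i) (U.V i) * A₂ := by
        rw [hV]; simp only [mul_assoc]
    _ = _ := by rw [c1]; simp only [mul_assoc]

/-- The tensor factors of a transversal operator of order two square to scalars. -/
theorem exists_factor_sq (i : Fin ℓ) : ∃ c : ℂ, c ^ 4 = 1 ∧ U.V i * U.V i = c • 1 := by
  have hV := (U.isPSC i).1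
  have h2 := U.order_two
  rw [List.ofFn_eq_map, pow_two] at h2
  -- Conjugating twice by the full product is trivial, and on factor `i` it is conjugation by the
  -- square of `U.V i`; so this square is central.
  have hcomm : ∀ B, Commute B (U.V i * U.V i) := by
    intro B
    have h := U.prod_mul_onQubits (List.nodup_finRange ℓ) (List.mem_finRange i)
    have : onQubits (U.site i) B = onQubits (U.site i)
        (U.V i * (U.V i * B * (U.V i)ᴴ) * (U.V i)ᴴ) := by
      have h' := h (U.V i * B * (U.V i)ᴴ)
      have h'' := h B
      set W := ((List.finRange ℓ).map fun j => onQubits (U.site j) (U.V j)).prod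
      calc onQubits (U.site i) B = W * W * onQubits (U.site i) B := by rw [h2, one_mul]
        _ = _ * (W * W) := by rw [mul_assoc, h'', ← mul_assoc, h', mul_assoc]
        _ = _ := by rw [h2, mul_one]
    have hB := onQubits_injective _ this
    rw [commute_iff_eq]
    nth_rw 1 [hB]
    calc U.V i * (U.V i * B * (U.V i)ᴴ) * (U.V i)ᴴ * (U.V i * U.V i)
        = U.V i * U.V i * B * ((U.V i)ᴴ * ((U.V i)ᴴ * U.V i) * U.V i) := by simp only [mul_assoc]
      _ = U.V i * U.V i * B := by rw [hV.star_mul, mul_one, hV.star_mul, mul_one]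
  obtain ⟨c, hc⟩ := eq_smul_one_of_commute fun p => hcomm (pauliString p)
  obtain ⟨d, p, hd, hp⟩ := (U.isPSC i).2.2
  refine ⟨c, ?_, hc⟩
  -- The square of the factor is both a scalar and a phased Pauli string; squaring once more removes
  -- the string and compares the phases.
  have hcd : (c * c) • (1 : Op (Fin (U.arity i))) = (d * d) • 1 := by
    rw [← smul_pauliString_mul_self d p, ← hp, hc, smul_mul_smul_comm, mul_one]
  have := smul_one_injective hcd
  calc c ^ 4 = (c * c) * (c * c) := by ring
    _ = d ^ 4 := by rw [this]; ring
    _ = 1 := hd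

end TransversalPSC

namespace ShorProtocol

variable {n ℓ m r : ℕ} (P : ShorProtocol n ℓ m r)

/-- The operator on the data qubits that is controlled by the ancilla `a`. -/
noncomputable def act (a : P.Ancilla) : Op (Fin n) :=
  match a.1.2 with
  | .inl i => onQubits (P.U.site i) (P.U.V i)
  | .inr (j, q) => onQubit q (P.check j q)

variable {P} in
theorem act_of_eq_inl {a : P.Ancilla} {i : Fin ℓ} (h : a.1.2 = .inl i) :
    P.act a = onQubits (P.U.site i) (P.U.V i) := by
  rw [act, h]

variable {P} in
theorem act_of_eq_inr {a : P.Ancilla} {j : Fin m} {q : Fin n} (h : a.1.2 = .inr (j, q)) :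
    P.act a = onQubit q (P.check j q) := by
  rw [act, h]

theorem gate_eq_ctl (a : P.Ancilla) : P.gate a = ctl a fun _ => P.act a := by
  rw [← controlled_eq_ctl]
  rcases h : a.1.2 with i | ⟨j, q⟩
  · rw [act_of_eq_inl h, gate, h]
    simp only [onQubits_trans]
  · rw [act_of_eq_inr h, ← blk_const, ← onQubit_inl, gate, h, onQubit]

/-- The error at each time is pushed through the gates still to come. A list of `l.length` gates has
`l.length + 1` times, the last one after all gates. -/
theorem noisyCircuit_eq {E : ℕ → Op P.Qubit} {N : ℕ → ℕ} {B : ℕ} {l : List P.Ancilla}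
    (hl : l.Nodup)
    (hE : ∀ t (l' : List P.Ancilla), l'.Nodup → Propagates P.act l' (E t) (N t * B)) :
    ∃ C, HasCost ((∑ t ∈ Finset.range (l.length + 1), N t) * B) C ∧
      noisyCircuit (l.map P.gate) E = C * circuit P.act l := by
  induction l generalizing E N with
  | nil =>
    obtain ⟨C, h1, h2⟩ := hE 0 [] List.nodup_nil
    refine ⟨C, by simpa using h1, ?_⟩
    rw [← h2, circuit_nil, one_mul, List.map_nil, noisyCircuit]
  | cons a l ih =>
    obtain ⟨C, h1, h2⟩ := ih (List.nodup_cons.1 hl).2 (E := fun t => E (t + 1))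
      (N := fun t => N (t + 1)) fun t => hE (t + 1)
    obtain ⟨C', h3, h4⟩ := hE 0 (a :: l) hl
    refine ⟨C * C', (h1.mul h3).mono (le_of_eq ?_), ?_⟩
    · rw [List.length_cons, Finset.sum_range_succ' _ (l.length + 1), add_mul]
    · rw [List.map_cons, noisyCircuit, h2, mul_assoc C, gate_eq_ctl, ← circuit_cons, mul_assoc, h4,
        mul_assoc]

/-! ### Counting gates -/

/-- The ancillas that control the tensor factor `i`. -/
noncomputable def factorAncillas (i : Fin ℓ) : Finset P.Ancilla :=
  Finset.univ.filter fun a => a.1.2 = .inl i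

/-- The ancillas that control Pauli operators on the data qubit `q`. -/
noncomputable def checkAncillas (q : Fin n) : Finset P.Ancilla :=
  open Classical in Finset.univ.filter fun a => ∃ j, a.1.2 = .inr (j, q)

/-- The ancillas that control tensor factors that act on the data qubit `q`. -/
noncomputable def factorAncillasAt (q : Fin n) : Finset P.Ancilla :=
  open Classical in Finset.univ.filter fun a => ∃ i, a.1.2 = .inl i ∧ q ∈ Set.range (P.U.site i)

/-- The ancillas that control Pauli operators on a data qubit in the support of the factor `i`. -/
noncomputable def nearbyAncillas (i : Fin ℓ) : Finset P.Ancilla :=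
  open Classical in Finset.univ.biUnion fun q' => P.checkAncillas (P.U.site i q')

/-- By disjointness at most one factor contains `q`, so such an ancilla is determined by its round.
-/
theorem card_factorAncillasAt_le (q : Fin n) : (P.factorAncillasAt q).card ≤ r := by
  classical
  have : (P.factorAncillasAt q).card ≤ (Finset.univ : Finset (Fin r)).card := by
    refine Finset.card_le_card_of_injOn (fun a => a.1.1) (fun _ _ => Finset.mem_univ _) ?_
    intro a ha b hb hab
    simp only [factorAncillasAt, Finset.coe_filter, Finset.mem_univ, true_and,
      Set.mem_ofPred_eq] at ha hb
    obtain ⟨i, hi, hqi⟩ := ha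
    obtain ⟨j, hj, hqj⟩ := hb
    have hij : i = j := by
      by_contra h
      exact Set.disjoint_left.1 (P.U.disjoint i j h) hqi hqj
    exact Subtype.ext (Prod.ext hab (by rw [hi, hj, hij]))
  simpa using this

theorem card_factorAncillas_le (i : Fin ℓ) : (P.factorAncillas i).card ≤ r := by
  have : (P.factorAncillas i).card ≤ (Finset.univ : Finset (Fin r)).card := by
    refine Finset.card_le_card_of_injOn (fun a => a.1.1) (fun _ _ => Finset.mem_univ _) ?_
    intro a ha b hb hab
    simp only [factorAncillas, Finset.coe_filter, Finset.mem_univ, true_and,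
      Set.mem_ofPred_eq] at ha hb
    exact Subtype.ext (Prod.ext hab (by rw [ha, hb]))
  simpa using this

/-- Such an ancilla is determined by its round and by a check acting nontrivially on `q`. -/
theorem card_checkAncillas_le (q : Fin n) : (P.checkAncillas q).card ≤ r * P.wq := by
  classical
  set S : Finset (Fin m) := Finset.univ.filter fun j => P.check j q ≠ .I with hS
  have hle : S.card ≤ P.wq := Finset.le_sup (f := fun q : Fin n =>
    (Finset.univ.filter fun j : Fin m => P.check j q ≠ .I).card) (Finset.mem_univ q)
  have : (P.checkAncillas q).card ≤
      ((Finset.univ : Finset (Fin r)) ×ˢ S.image fun j => (Sum.inr (j, q) : Fin ℓ ⊕ Fin m × Fin n)).card := by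
    refine Finset.card_le_card_of_injOn (fun a => a.1) ?_ Subtype.val_injective.injOn
    intro a ha
    simp only [checkAncillas, Finset.coe_filter, Finset.mem_univ, true_and, Set.mem_ofPred_eq] at ha
    obtain ⟨j, hj⟩ := ha
    obtain ⟨⟨t, x⟩, hx⟩ := a
    subst hj
    obtain ⟨s, -, -, h⟩ := hx
    simp [hS, h]
  refine this.trans ?_
  rw [Finset.card_product, Finset.card_univ, Fintype.card_fin]
  exact Nat.mul_le_mul_left _ (Finset.card_image_le.trans hle)

theorem card_nearbyAncillas_le (i : Fin ℓ) :
    (P.nearbyAncillas i).card ≤ P.U.arity i * (r * P.wq) := by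
  classical
  have := Finset.card_biUnion_le_card_mul (Finset.univ : Finset (Fin (P.U.arity i)))
    (fun q' => P.checkAncillas (P.U.site i q')) (r * P.wq) fun q' _ => P.card_checkAncillas_le _
  rwa [Finset.card_univ, Fintype.card_fin] at this

/-! ### Propagation of single-qubit errors -/

variable {P} in
-- Seen from the support of factor `i`, a gate is invisible, a single-qubit Pauli inside it, or the
-- factor itself; these are the cases of `propagates_blk_factor`.
theorem act_cases (i : Fin ℓ) (b : P.Ancilla) :
    (∀ B : Op (Fin (P.U.arity i)), Commute (P.act b) (onQubits (P.U.site i) B)) ∨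
      (b ∈ P.nearbyAncillas i ∧
        ∃ q' σ, P.act b = onQubits (P.U.site i) (onQubit q' σ)) ∨
      (b ∈ P.factorAncillas i ∧ P.act b = onQubits (P.U.site i) (P.U.V i)) := by
  rcases h : b.1.2 with i' | ⟨j, q⟩
  · by_cases hi : i' = i
    · subst hi
      exact Or.inr (Or.inr ⟨by simpa [factorAncillas] using h, act_of_eq_inl h⟩)
    · refine Or.inl fun B => ?_
      rw [act_of_eq_inl h]
      exact onQubits_commute (P.U.disjoint _ _ hi) _ _
  · by_cases hq : q ∈ Set.range (P.U.site i)
    · obtain ⟨q', rfl⟩ := hq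
      refine Or.inr (Or.inl ⟨?_, q', P.check j (P.U.site i q'), ?_⟩)
      · simp only [nearbyAncillas, Finset.mem_biUnion, checkAncillas, Finset.mem_filter,
          Finset.mem_univ, true_and]
        exact ⟨q', j, h⟩
      · rw [act_of_eq_inr h, onQubits_onQubit]
    · refine Or.inl fun B => ?_
      rw [act_of_eq_inr h]
      exact commute_onQubit_onQubits hq _ _

theorem propagates_ctl_onQubits {k : ℕ} (hk : ∀ i, P.U.arity i ≤ k)
    {i : Fin ℓ} {Q : Op (Fin (P.U.arity i))} (hQ : IsPauli Q)
    (hVQ : P.U.V i * Q = Q * P.U.V i ∨ P.U.V i * Q = -(Q * P.U.V i)) (a : P.Ancilla)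
    {l : List P.Ancilla} (hl : l.Nodup) :
    Propagates P.act l (ctl a fun _ => onQubits (P.U.site i) Q)
      (6 * k + 30 + (k * (r * P.wq) + r) * 16) := by
  classical
  have hcost := hQ.pauliOn.onQubits (f := P.U.site i)
  refine (propagates_ctl (hcost.hasCost_ctl (w := k) (by simpa using hk i) a)
    (T := P.nearbyAncillas i ∪ P.factorAncillas i) (fun b => ?_) hl).mono ?_
  · rcases act_cases i b with h | ⟨hb, q', σ, h⟩ | ⟨hb, h⟩
    · exact Or.inl (h Q)
    · rw [h, ← onQubits_mul, ← onQubits_mul]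
      rcases (isInvolutivePauli_onQubit q' σ).1.mul_comm hQ with h' | h'
      · exact Or.inl (by rw [h'])
      · exact Or.inr ⟨Finset.mem_union_left _ hb, by
          rw [h', ← neg_one_smul ℂ, onQubits_smul, neg_one_smul]⟩
    · rw [h, ← onQubits_mul, ← onQubits_mul]
      rcases hVQ with h' | h'
      · exact Or.inl (by rw [h'])
      · exact Or.inr ⟨Finset.mem_union_right _ hb, by
          rw [h', ← neg_one_smul ℂ, onQubits_smul, neg_one_smul]⟩
  · refine Nat.add_le_add_left (Nat.mul_le_mul_right _ ?_) _
    refine (Finset.card_union_le _ _).trans (Nat.add_le_add ?_ (P.card_factorAncillas_le i))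
    exact (P.card_nearbyAncillas_le i).trans (Nat.mul_le_mul_right _ (hk i))

/-- The summands are the error itself, a `Z` for each check meeting `q`, and for each round a
controlled Pauli together with all its controlled signs. -/
theorem propagates_data_pauli {k : ℕ} (hk : ∀ i, P.U.arity i ≤ k) (q : Fin n) (σ : Pauli)
    {l : List P.Ancilla} (hl : l.Nodup) :
    Propagates P.act l (blk fun _ => onQubit q σ)
      (7 + (r * P.wq * 10 + r * (6 * k + 30 + (k * (r * P.wq) + r) * 16))) := by
  classical
  have : Nonempty P.Qubit := ⟨.inl q⟩
  have hcost : HasCost 7 (blk fun _ : P.Ancilla → Fin 2 => onQubit q σ) := by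
    rw [← onQubit_inl]
    exact (pauliOn_onQubit _ σ).hasCost (w := 1) (by simp)
  have hσ := isInvolutivePauli_onQubit q σ
  refine (propagates_blk_pauli hcost (T₁ := P.checkAncillas q) (T₂ := P.factorAncillasAt q)
    (N := 6 * k + 30 + (k * (r * P.wq) + r) * 16) (fun b => ?_) hl).mono ?_
  · rcases h : b.1.2 with i | ⟨j, q'⟩
    · rw [act_of_eq_inl h]
      by_cases hq : q ∈ Set.range (P.U.site i)
      · have hb : b ∈ P.factorAncillasAt q := by simpa [factorAncillasAt] using ⟨i, h, hq⟩
        obtain ⟨q', rfl⟩ := hq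
        refine Or.inr (Or.inr ⟨hb, ?_⟩)
        have hV := (P.U.isPSC i).1
        obtain ⟨c, -, hc⟩ := P.U.exists_factor_sq i
        rw [← onQubits_onQubit]
        have hp := isInvolutivePauli_onQubit q' σ
        set p := onQubit q' σ
        clear_value p
        have hp' := hV.conj_isInvolutivePauli hp
        have hvp := hV.conj_mul p
        have hvp' : P.U.V i * (P.U.V i * p * (P.U.V i)ᴴ) = p * P.U.V i := by
          rw [← mul_assoc, ← mul_assoc, hc, smul_mul_assoc, one_mul, smul_mul_assoc,
            ← mul_smul_comm]
          congr 1
          calc c • (P.U.V i)ᴴ = (P.U.V i * P.U.V i) * (P.U.V i)ᴴ := by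
                rw [hc, smul_mul_assoc, one_mul]
            _ = P.U.V i := by rw [mul_assoc, hV.mul_star, mul_one]
        set v := P.U.V i
        set p' := v * p * vᴴ
        clear_value p'
        refine ⟨onQubits (P.U.site i) (p * p'), ?_, fun l hl => ?_⟩
        · rw [← onQubits_mul, ← onQubits_mul, ← onQubits_mul, ← mul_assoc p, hp.2, one_mul, hvp]
        · refine P.propagates_ctl_onQubits hk (hp.1.mul hp'.1) ?_ b hl
          -- Since `v` swaps `p` and `p'`, it reverses their product, so it commutes or anticommutes
          -- with `p * p'` just as `p` and `p'` do with each other.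
          have e : v * (p * p') = p' * p * v := by
            rw [← mul_assoc, ← hvp, mul_assoc, hvp', mul_assoc]
          rcases hp'.1.mul_comm hp.1 with h' | h'
          · exact Or.inl (by rw [e, h'])
          · exact Or.inr (by rw [e, h', neg_mul])
      · exact Or.inl (commute_onQubit_onQubits hq σ _).eq.symm
    · rw [act_of_eq_inr h]
      by_cases hq : q' = q
      · subst hq
        rcases (isInvolutivePauli_onQubit q' (P.check j q')).1.mul_comm hσ.1 with h' | h'
        · exact Or.inl h'
        · exact Or.inr (Or.inl ⟨by simpa [checkAncillas] using ⟨j, h⟩, h'⟩)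
      · exact Or.inl (onQubit_mul_onQubit_of_ne hq _ _).eq
  · exact Nat.add_le_add_left (Nat.add_le_add (Nat.mul_le_mul_right _ (P.card_checkAncillas_le q))
      (Nat.mul_le_mul_right _ (P.card_factorAncillasAt_le q))) _

theorem propagates_factor [Nonempty P.Qubit] {k : ℕ} (hk : ∀ i, P.U.arity i ≤ k) (i : Fin ℓ)
    {l : List P.Ancilla} (hl : l.Nodup) :
    Propagates P.act l (blk fun _ => onQubits (P.U.site i) (P.U.V i))
      (2 * (k * (r * P.wq) * 36) + (4 * k * (2 * k + 1) + 1) + r * (k * (r * P.wq) * 16)) := by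
  have hV := (P.U.isPSC i).1
  obtain ⟨c, -, hc⟩ := P.U.exists_factor_sq i
  have hcost : HasCost (4 * k * (2 * k + 1) + 1)
      (blk fun _ : P.Ancilla → Fin 2 => onQubits (P.U.site i) (P.U.V i)) := by
    rw [blk_const, ← onQubits_trans]
    exact hV.hasCost_onQubits _ (by simpa using hk i)
  refine (propagates_blk_factor hV hc hcost (T₁ := P.nearbyAncillas i) (T₂ := P.factorAncillas i)
    (N := 36) (fun b => ?_) hl).mono ?_
  · rcases act_cases i b with h | ⟨hb, q', σ, h⟩ | h
    · exact Or.inl h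
    · refine Or.inr (Or.inl ⟨hb, ?_, _, isInvolutivePauli_onQubit q' σ, h⟩)
      rw [h, onQubits_onQubit]
      exact (pauliOn_onQubit _ σ).hasCost_ctl (w := 1) (by simp) b
    · exact Or.inr (Or.inr h)
  · have h1 : (P.nearbyAncillas i).card ≤ k * (r * P.wq) :=
      (P.card_nearbyAncillas_le i).trans (Nat.mul_le_mul_right _ (hk i))
    have h2 := P.card_factorAncillas_le i
    gcongr

theorem propagates_onQubit {k : ℕ} (hk : ∀ i, P.U.arity i ≤ k) (hr : 1 ≤ r) (hw : 1 ≤ P.wq)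
    (x : P.Qubit) (σ : Pauli)
    {l : List P.Ancilla} (hl : l.Nodup) : Propagates P.act l (onQubit x σ)
      ((8 * k ^ 2 + 130 * k + 200) * (r ^ 2 * P.wq)) := by
  have : Nonempty P.Qubit := ⟨x⟩
  obtain ⟨w, hwdef⟩ : ∃ w, w = P.wq := ⟨_, rfl⟩
  -- As `r` and `w` are at least 1, `R` dominates the monomials `1`, `r`, `r * r` and `r * w`, so
  -- every bound becomes a polynomial in `k` times `R`.
  obtain ⟨R, hR⟩ : ∃ R, R = r ^ 2 * w := ⟨_, rfl⟩
  have hR1 : r * w ≤ R := by rw [hR, pow_two]; nlinarith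
  have hR2 : r * r ≤ R := by rw [hR, pow_two]; nlinarith
  have hR3 : r * (r * w) = R := by rw [hR]; ring
  have hR4 : r ≤ r * r := by nlinarith
  have hR5 : 1 ≤ R := by omega
  have hdata : ∀ q σ {l : List P.Ancilla}, l.Nodup → Propagates P.act l (blk fun _ => onQubit q σ)
      ((22 * k + 63) * R) := by
    intro q σ l hl
    refine (P.propagates_data_pauli hk q σ hl).mono ?_
    rw [← hwdef]
    calc 7 + (r * w * 10 + r * (6 * k + 30 + (k * (r * w) + r) * 16))
        = 7 + 10 * (r * w) + 6 * k * r + 30 * r + 16 * k * (r * (r * w)) + 16 * (r * r) := by ring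
      _ ≤ 7 * R + 10 * R + 6 * k * R + 30 * R + 16 * k * R + 16 * R := by
        rw [hR3]
        gcongr <;> omega
      _ ≤ _ := by ring_nf; omega
  have hfactor : ∀ i {l : List P.Ancilla}, l.Nodup →
      Propagates P.act l (blk fun _ => onQubits (P.U.site i) (P.U.V i))
        ((8 * k ^ 2 + 92 * k + 1) * R) := by
    intro i l hl
    refine (P.propagates_factor hk i hl).mono ?_
    rw [← hwdef]
    calc 2 * (k * (r * w) * 36) + (4 * k * (2 * k + 1) + 1) + r * (k * (r * w) * 16)
        = 72 * k * (r * w) + (8 * k ^ 2 + 4 * k + 1) * 1 + 16 * k * (r * (r * w)) := by ring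
      _ ≤ 72 * k * R + (8 * k ^ 2 + 4 * k + 1) * R + 16 * k * R := by
        rw [hR3]
        gcongr
      _ ≤ _ := le_of_eq (by ring)
  have hact : ∀ a {l : List P.Ancilla}, l.Nodup → Propagates P.act l (blk fun _ => P.act a)
      ((8 * k ^ 2 + 114 * k + 64) * R) := by
    intro a l hl
    rcases h : a.1.2 with i | ⟨j, q⟩
    · rw [act_of_eq_inl h]
      exact (hfactor i hl).mono (Nat.mul_le_mul_right _ (by omega))
    · rw [act_of_eq_inr h]
      exact (hdata _ _ hl).mono (Nat.mul_le_mul_right _ (by omega))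
  have hX : ∀ a {l : List P.Ancilla}, l.Nodup → Propagates P.act l (onQubit (.inr a) .X)
      ((8 * k ^ 2 + 114 * k + 91) * R) := by
    intro a l hl
    obtain ⟨c, hc4, hc⟩ : ∃ c : ℂ, c ^ 4 = 1 ∧ P.act a * P.act a = c • 1 := by
      rcases h : a.1.2 with i | ⟨j, q⟩
      · obtain ⟨c, hc4, hc⟩ := P.U.exists_factor_sq i
        exact ⟨c, hc4, by rw [act_of_eq_inl h, ← onQubits_mul, hc, onQubits_smul, onQubits_one]⟩
      · exact ⟨1, by norm_num, by
          rw [act_of_eq_inr h, (isInvolutivePauli_onQubit _ _).2, one_smul]⟩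
    refine (propagates_onQubit_X hc hc4 (fun l hl => hact a hl) hl).mono ?_
    calc 27 + (8 * k ^ 2 + 114 * k + 64) * R ≤ 27 * R + (8 * k ^ 2 + 114 * k + 64) * R := by omega
      _ = _ := by ring
  have hZ : ∀ a {l : List P.Ancilla}, Propagates P.act l (onQubit (.inr a) .Z) 7 := by
    intro a l
    refine ((pauliOn_onQubit (.inr a : P.Qubit) .Z).hasCost (w := 1)
      (by simp)).propagates_of_commute fun b _ => ?_
    rw [onQubit_inr_Z]
    have := commute_blk_smul_one (fun x => if x b = 1 then P.act b else 1)
      fun x => if x a = 1 then -1 else 1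
    simp only [ite_smul, neg_smul, one_smul] at this
    exact this
  rw [← hwdef, ← hR]
  rcases x with q | a
  · rw [onQubit_inl]
    exact (hdata q σ hl).mono (Nat.mul_le_mul_right _ (by nlinarith))
  · cases σ
    · rw [onQubit_I]; exact propagates_one.mono (Nat.zero_le _)
    · exact (hX a hl).mono (Nat.mul_le_mul_right _ (by omega))
    · have hI : Propagates P.act l (Complex.I • (1 : Op P.Qubit)) 1 :=
        (hasCost_smul_one (star_mul_self_of_pow_four I_pow_four)).propagates_of_commute fun b _ =>
          (Commute.one_right _).smul_right _
      have := hI.mul ((hX a hl).mul (hZ a))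
      rw [smul_mul_assoc, one_mul, ← onQubit_Y] at this
      refine this.mono ?_
      calc 1 + ((8 * k ^ 2 + 114 * k + 91) * R + 7)
          ≤ (8 * k ^ 2 + 114 * k + 91) * R + 8 * R := by omega
        _ = (8 * k ^ 2 + 114 * k + 99) * R := by ring
        _ ≤ _ := Nat.mul_le_mul_right _ (by omega)
    · exact (hZ a).mono (by nlinarith [Nat.zero_le k, Nat.zero_le (k ^ 2 * R), Nat.zero_le (k * R)])

/-- Each element is counted at one time only; this makes the total linear in the number of error
locations, regardless of circuit length. -/
theorem sum_length_filter_le {β : Type*} (L : List β) (f : β → ℕ) (N : ℕ) :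
    ∑ t ∈ Finset.range N, (L.filter fun i => f i = t).length ≤ L.length := by
  induction L with
  | nil => simp
  | cons b L ih =>
    have : ∀ t, ((b :: L).filter fun i => f i = t).length =
        (L.filter fun i => f i = t).length + if f b = t then 1 else 0 := by
      intro t
      rw [List.filter_cons]
      split_ifs <;> simp_all
    simp only [this, Finset.sum_add_distrib, List.length_cons, Finset.sum_ite_eq]
    split_ifs <;> omega

end ShorProtocol

end ShorStyle

/-! ### The bound for arbitrary error configurations -/

open ShorStyle
theorem corollary2 (k s : ℕ) :
    ∃ K : ℕ, ∀ (n ℓ m r : ℕ) (P : ShorProtocol n ℓ m r),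
      (∀ i, P.U.arity i ≤ k) → 1 ≤ r → 1 ≤ P.wq →
      ∀ (M : ℕ) (e : P.ErrorConfiguration M),
        (∀ i, (e.loc i).qubits.card ≤ s) →
        ∃ L : List (Op P.Qubit),
          (∀ G ∈ L, IsOneOrTwoQubitClifford G) ∧
          L.length ≤ K * (M * r ^ 2 * P.wq) ∧
          IsClifford L.prod ∧
          P.noisy e = L.prod * P.ideal ∧
          ∀ ψ : (Fin n → Fin 2) → ℂ,
            P.noisy e *ᵥ P.input ψ = L.prod *ᵥ (P.ideal *ᵥ P.input ψ) := by
  -- An error at one location is a product of at most `s` single-qubit Paulis, each with the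
  -- constant of `propagates_onQubit`.
  refine ⟨s * (8 * k ^ 2 + 130 * k + 200), fun n ℓ m r P hk hr hw M e hs => ?_⟩
  set B := s * ((8 * k ^ 2 + 130 * k + 200) * (r ^ 2 * P.wq)) with hB
  have herr : ∀ i (l : List P.Ancilla), l.Nodup →
      Propagates P.act l (pauliString (e.err i)) B := by
    intro i l hl
    obtain ⟨L, hL, h⟩ := pauliString_eq_list_prod (e.loc i).qubits (e.err i) (e.err_supp i)
    rw [h]
    refine (propagates_list_prod (N := (8 * k ^ 2 + 130 * k + 200) * (r ^ 2 * P.wq))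
      fun E hE => ?_).mono ?_
    · obtain ⟨⟨x, σ⟩, -, rfl⟩ := List.mem_map.1 hE
      exact P.propagates_onQubit hk hr hw x σ hl
    · rw [List.length_map]
      exact Nat.mul_le_mul_right _ (hL.trans (hs i))
  obtain ⟨C, ⟨L, hL, hlen, rfl⟩, hC⟩ := P.noisyCircuit_eq P.schedule_nodup (E := e.errorAt)
    (N := fun t => ((List.finRange M).filter fun i => ((e.loc i).time : ℕ) = t).length) (B := B)
    (fun t l hl => by
      have := propagates_list_prod (act := P.act) (l := l) (N := B)
        (L := ((List.finRange M).filter fun i => ((e.loc i).time : ℕ) = t).map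
          fun i => pauliString (e.err i)) fun E hE => by
            obtain ⟨i, -, rfl⟩ := List.mem_map.1 hE
            exact herr i l hl
      rwa [List.length_map] at this)
  have hideal : P.ideal = circuit P.act P.schedule := by
    rw [ShorProtocol.ideal, ShorProtocol.gates, circuit]
    rw [List.map_congr_left fun a _ => P.gate_eq_ctl a]
  have hnoisy : P.noisy e = L.prod * P.ideal := by
    rw [hideal, ← hC, ShorProtocol.noisy, ShorProtocol.gates]
  refine ⟨L, fun G hG => (hL G hG).1, hlen.trans ?_, isClifford_list_prod fun G hG => (hL G hG).2,
    hnoisy, fun ψ => by rw [hnoisy, Matrix.mulVec_mulVec]⟩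
  have h := ShorProtocol.sum_length_filter_le (List.finRange M) (fun i => ((e.loc i).time : ℕ))
    (P.schedule.length + 1)
  rw [List.length_finRange] at h
  calc _ ≤ M * B := Nat.mul_le_mul_right _ h
    _ = _ := by rw [hB]; ring
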